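/- Let $n\ge 1$ and let $\Omega\subset\mathbb R^n$ be a bounded domain (nonempty, open, connected) with Lipschitz boundary. There is a constant $C>0$, depending only on $\Omega$, such that for every $F\in L^2(\Omega;\mathbb R^n)$ and every $H\in L^\infty(\Omega)$ with $\|H\|_{L^\infty(\Omega)}<C$ the equation $$\nabla\cdot\left(\frac{Du+F}{|Du+F|}\right)=H-\bar H\quad\text{in }\Omega,\qquad \bar H:=\frac1{|\Omega|}\int_\Omega H\,dx,$$ has a solution $u\in BV(\Omega)$ in the following sense. Write $Du+F$ for the $\mathbb R^n$-valued measure $Du+F\,dx$ on $\Omega$ and $|Du+F|$ for its total variation measure. There are $u\in BV(\Omega)$ and a vector field $N$ with $|N|\le 1$ a.e. in $\Omega$ such that 1. $N\in\mathcal D_0$, where $$\mathcal D_0=\Big\{b\in L^2(\Omega;\mathbb R^n):\ \int_\Omega (\nabla v\cdot b+Hv)\,dx=0\ \text{ for all } v\in H^1(\Omega)\text{ with }\int_\Omega v\,dx=0\Big\};$$ 2. $\nabla\cdot N=H-\bar H$ in the sense of distributions in $\Omega$; 3. $N=\dfrac{Du+F}{|Du+F|}$ holds $|Du+F|$-a.e.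 in $\Omega$ (for a suitable pointwise representative of $N$), where $\frac{Du+F}{|Du+F|}$ is the Radon–Nikodym density of $Du+F$ with respect to $|Du+F|$; 4. moreover, $(N,Du)+N\cdot F\,dx=|Du+F|$ as measures on $\Omega$, where $(N,Du)$ is the Anzellotti pairing, defined by $\langle (N,Du),\varphi\rangle=-\int_\Omega u\,\varphi\,\nabla\cdot N\,dx-\int_\Omega u\,N\cdot\nabla\varphi\,dx$ for $\varphi\in C_c^\infty(\Omega)$. -/

import Mathlib

open MeasureTheory Set Metric
open scoped NNReal ContDiff Gradient

noncomputable section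

namespace PArea

/-- Euclidean space `ℝⁿ`. -/
abbrev Euc (n : ℕ) : Type := EuclideanSpace ℝ (Fin n)

/-- `Ω` has Lipschitz boundary: near each boundary point, `Ω` is the part of a ball lying strictly
above the graph of a Lipschitz function, in the direction of some unit vector `e`.
The point `y - ⟪e, y⟫ e` is the orthogonal projection of `y` to the hyperplane `e^⊥`, so `γ` is
only evaluated on that hyperplane. -/
def HasLipschitzBoundary {n : ℕ} (Ω : Set (Euc n)) : Prop :=
  ∀ x ∈ frontier Ω, ∃ (e : Euc n) (γ : Euc n → ℝ) (K : ℝ≥0) (r : ℝ),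
    ‖e‖ = 1 ∧ LipschitzWith K γ ∧ 0 < r ∧
      Ω ∩ ball x r = {y | γ (y - (inner ℝ e y) • e) < inner ℝ e y} ∩ ball x r

/-- `φ ∈ C_c^∞(Ω)`. -/
structure IsTestFunction {n : ℕ} (Ω : Set (Euc n)) (φ : Euc n → ℝ) : Prop where
  smooth : ContDiff ℝ ∞ φ
  compactSupport : HasCompactSupport φ
  support_subset : tsupport φ ⊆ Ω

/-- `G` is the weak gradient of `u` in `Ω`. -/
def IsWeakGradient {n : ℕ} (Ω : Set (Euc n)) (u : Euc n → ℝ) (G : Euc n → Euc n) : Prop :=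
  ∀ φ : Euc n → ℝ, IsTestFunction Ω φ →
    ∫ x in Ω, u x • ∇ φ x = - ∫ x in Ω, φ x • G x

/-- `u ∈ H¹(Ω)`, with weak gradient `G`. -/
structure HasH1Gradient {n : ℕ} (Ω : Set (Euc n)) (u : Euc n → ℝ) (G : Euc n → Euc n) :
    Prop where
  memLp : MemLp u 2 (volume.restrict Ω)
  memLp_grad : MemLp G 2 (volume.restrict Ω)
  isWeakGradient : IsWeakGradient Ω u G

/-- `u ∈ BV(Ω)`, with distributional gradient `Du = D`: a vector measure on `Ω` (that is, one
concentrated on `Ω`) of finite total variation. -/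
structure HasBVGradient {n : ℕ} (Ω : Set (Euc n)) (u : Euc n → ℝ)
    (D : VectorMeasure (Euc n) (Euc n)) : Prop where
  integrableOn : IntegrableOn u Ω
  variation_lt_top : D.variation univ < ⊤
  variation_compl : D.variation Ωᶜ = 0
  integral_eq : ∀ φ : Euc n → ℝ, IsTestFunction Ω φ →
    ∫ x in Ω, u x • ∇ φ x = - VectorMeasure.integral D φ (ContinuousLinearMap.lsmul ℝ ℝ)

/-- The function `d` is the distributional divergence of the vector field `N` in `Ω`. -/
def IsWeakDivergence {n : ℕ} (Ω : Set (Euc n)) (N : Euc n → Euc n) (d : Euc n → ℝ) : Prop :=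
  ∀ φ : Euc n → ℝ, IsTestFunction Ω φ →
    ∫ x in Ω, inner ℝ (N x) (∇ φ x) = - ∫ x in Ω, d x * φ x

/-- The class `𝒟₀`: fields `b ∈ L²(Ω)ⁿ` with `∫_Ω ∇v · b + H v = 0` for all `v ∈ H¹(Ω)` with
`∫_Ω v = 0`. -/
def DZero {n : ℕ} (Ω : Set (Euc n)) (H : Euc n → ℝ) : Set (Euc n → Euc n) :=
  {b | MemLp b 2 (volume.restrict Ω) ∧
    ∀ (v : Euc n → ℝ) (G : Euc n → Euc n), HasH1Gradient Ω v G → ∫ x in Ω, v x = 0 →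
      ∫ x in Ω, (inner ℝ (G x) (b x) + H x * v x) = 0}

/-- The vector measure `Du + F dx` on `Ω`, where `Du = D`. Its total variation `|Du + F|` is
`(addField Ω D F).variation`. -/
def addField {n : ℕ} (Ω : Set (Euc n)) (D : VectorMeasure (Euc n) (Euc n))
    (F : Euc n → Euc n) : VectorMeasure (Euc n) (Euc n) :=
  D + (volume.restrict Ω).withDensityᵥ F

/-- `σ = T / |T|`: the field `σ` is (a version of) the Radon-Nikodym density of the vector measure
`T` with respect to its total variation `|T|`, that is, `T = σ |T|`. -/
def IsPolarDensity {n : ℕ} (T : VectorMeasure (Euc n) (Euc n)) (σ : Euc n → Euc n) : Prop :=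
  Integrable σ T.variation ∧ T.variation.withDensityᵥ σ = T

/-- Anzellotti's pairing `(N, Du)` of a bounded field `N` with divergence `d` and a function
`u` of bounded variation, as a distribution:
`⟨(N, Du), φ⟩ = - ∫_Ω u φ d - ∫_Ω u N · ∇φ`. -/
def pairing {n : ℕ} (Ω : Set (Euc n)) (N : Euc n → Euc n) (d u φ : Euc n → ℝ) : ℝ :=
  - (∫ x in Ω, u x * φ x * d x) - ∫ x in Ω, u x * inner ℝ (N x) (∇ φ x)

end PArea

end

/-! Consider `J(v) = ∫_Ω |∇v + F| + H v` on mean-zero `v ∈ H¹(Ω)`. The Poincaré inequality `∫|v| ≤ C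
∫|∇v|` gives `|∫ H v| ≤ ‖H‖_∞ C ∫|∇v|`. So if `‖H‖_∞ < C⁻¹`, then `J` is bounded below and its
minimizing sequences are bounded in `W^{1,1}`. This is where the constant of the theorem comes from.

The field `N` is produced by duality rather than by an Euler-Lagrange equation. With `m = inf J`,
the functional `∇v + tF ↦ -∫ H v + t m` is dominated by the `L¹` norm. Hahn-Banach extends it to
`L²` under the same bound, and Riesz represents it by a field `N` with `|N| ≤ 1`. Then `N ∈ 𝒟₀` and
`∫ N · F = m`, so along a minimizing sequence `u_k` the nonnegative defect `|∇u_k + F| - N · (∇u_k +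
F)` tends to zero in `L¹` (`exists_calibration`, `exists_calibrated_sequence`).

Rellich's theorem gives `u_k → u` in `L¹(Ω)` along an ultrafilter. Vague compactness gives `(∇u_k +
F) dx → τ ν` and `|∇u_k + F| dx → ν`. Since `(N, Du_k) = N · ∇u_k dx` and the pairing is continuous
in `u` for `L¹` convergence, the limit satisfies `(N, Du) + N · F dx = ν` in `Ω`, with `Du + F dx =
τ ν` (`exists_limit_of_calibrated_sequence`).

It remains to see that `ν = |Du + F|` and that `N` is its density. Mollifying `φ N` bounds the
pairing identity from above: `∫ φ dν ≤ ∫ φ h dν` with `h = N · τ` on the absolutely continuous part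
of `ν` and `h = |τ|` on the singular part. As `h ≤ 1`, equality holds. Hence `|τ| = 1`, and `N = τ`
off a Lebesgue null set, on which `N` may be redefined as `τ` (`ae_eq_of_pairing_eq`).

Both Poincaré and Rellich rest on one estimate, `∫_A |v(x+h) - v(x)| ≤ |h| ∫|G|` whenever the
segments from `A` stay in `Ω` (`lintegral_enorm_translate_sub_le`), and on pushing boundary patches
into `Ω` (`lipschitz_domain_induction`). -/

noncomputable section

namespace PArea

open Filter Topology ContinuousLinearMap
open scoped Convolution ENNReal BoundedContinuousFunction

/-! ### Mollifiers and the translation estimate for Sobolev functions -/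

section Mollification

variable {n : ℕ}

/-- An integrable function on the whole space, vanishing off `Ω`, whose weak gradient in `Ω` is the
integrable field `G`, also vanishing off `Ω`. -/
structure SobolevPair (Ω : Set (Euc n)) (v : Euc n → ℝ) (G : Euc n → Euc n) : Prop where
  measurable : Measurable v
  integrable : Integrable v
  integrable_grad : Integrable G
  eq_zero : ∀ x ∉ Ω, v x = 0
  grad_eq_zero : ∀ x ∉ Ω, G x = 0
  isWeakGradient : IsWeakGradient Ω v G

/-- A sequence of bump functions shrinking to the origin. -/
def bump (n k : ℕ) : ContDiffBump (0 : Euc n) where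
  rIn := 1 / ((k : ℝ) + 1)
  rOut := 2 * (1 / ((k : ℝ) + 1))
  rIn_pos := by positivity
  rIn_lt_rOut := by
    have : 0 < 1 / ((k : ℝ) + 1) := by positivity
    linarith

/-- The standard mollifiers. -/
def mollifier (n k : ℕ) : Euc n → ℝ := (bump n k).normed volume

/-- Mollification. -/
def mollify {V : Type*} [NormedAddCommGroup V] [NormedSpace ℝ V] (k : ℕ) (f : Euc n → V) :
    Euc n → V := mollifier n k ⋆[lsmul ℝ ℝ] f

lemma tendsto_bump_rOut : Tendsto (fun k => (bump n k).rOut) atTop (𝓝 0) := by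
  have := (tendsto_one_div_add_atTop_nhds_zero_nat (𝕜 := ℝ)).const_mul 2
  simpa [bump] using this

lemma contDiff_mollifier (k : ℕ) : ContDiff ℝ ∞ (mollifier n k) := (bump n k).contDiff_normed

lemma mollifier_nonneg (k : ℕ) (x : Euc n) : 0 ≤ mollifier n k x := (bump n k).nonneg_normed x

lemma continuous_mollifier (k : ℕ) : Continuous (mollifier n k) := (contDiff_mollifier k).continuous

lemma hasCompactSupport_mollifier (k : ℕ) : HasCompactSupport (mollifier n k) :=
  (bump n k).hasCompactSupport_normed

lemma support_mollifier (k : ℕ) : Function.support (mollifier n k) = ball 0 (bump n k).rOut :=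
  (bump n k).support_normed_eq

lemma integral_mollifier (k : ℕ) : ∫ x, mollifier n k x = 1 := (bump n k).integral_normed

lemma integrable_mollifier (k : ℕ) : Integrable (mollifier n k) := (bump n k).integrable_normed

lemma lintegral_mollifier (k : ℕ) : ∫⁻ x, ‖mollifier n k x‖ₑ = 1 := by
  rw [← ofReal_integral_norm_eq_lintegral_enorm (integrable_mollifier k)]
  simp [mollifier_nonneg, integral_mollifier, abs_of_nonneg]

section

variable {V : Type*} [NormedAddCommGroup V] [NormedSpace ℝ V]

lemma mollify_apply (k : ℕ) (f : Euc n → V) (x : Euc n) :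
    mollify k f x = ∫ y, mollifier n k (x - y) • f y := by
  simp only [mollify, convolution_lsmul_swap]

lemma mollify_apply' (k : ℕ) (f : Euc n → V) (x : Euc n) :
    mollify k f x = ∫ y, mollifier n k y • f (x - y) := by
  simp only [mollify, convolution_lsmul]

lemma contDiff_mollify (k : ℕ) {f : Euc n → V} (hf : LocallyIntegrable f) :
    ContDiff ℝ ∞ (mollify k f) :=
  (hasCompactSupport_mollifier k).contDiff_convolution_left _ (contDiff_mollifier k) hf

lemma ae_tendsto_mollify [CompleteSpace V] {f : Euc n → V} (hf : LocallyIntegrable f) :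
    ∀ᵐ x, Tendsto (fun k => mollify k f x) atTop (𝓝 (f x)) :=
  ContDiffBump.ae_convolution_tendsto_right_of_locallyIntegrable (K := 2) tendsto_bump_rOut
    (Eventually.of_forall fun _ => le_rfl) hf

lemma integrable_mollifier_smul (k : ℕ) {f : Euc n → V} (hf : LocallyIntegrable f) (x : Euc n) :
    Integrable fun y => mollifier n k (x - y) • f y :=
  ((hasCompactSupport_mollifier k).convolutionExists_left (lsmul ℝ ℝ)
    (continuous_mollifier k) hf x).integrable_swap

lemma fderiv_mollify (k : ℕ) {f : Euc n → ℝ} (hf : LocallyIntegrable f) (x h : Euc n) :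
    HasFDerivAt (mollify k f) (fderiv ℝ (mollify k f) x) x ∧
    fderiv ℝ (mollify k f) x h = ∫ y, f y * fderiv ℝ (mollifier n k) (x - y) h := by
  have h1 := (hasCompactSupport_mollifier (n := n) k).hasFDerivAt_convolution_left (lsmul ℝ ℝ)
    ((contDiff_mollifier k).of_le (by simp)) hf x
  refine ⟨h1.differentiableAt.hasFDerivAt, ?_⟩
  have h2 : fderiv ℝ (mollify k f) x = _ := h1.fderiv
  rw [h2, convolution_eq_swap, ContinuousLinearMap.integral_apply]
  · simp [mul_comm]
  · exact (((hasCompactSupport_mollifier k).fderiv ℝ).convolutionExists_left _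
      ((contDiff_mollifier k).continuous_fderiv (by simp)) hf x).integrable_swap

end

lemma isTestFunction_mollifier {Ω : Set (Euc n)} {k : ℕ} {x : Euc n}
    (hx : closedBall x (bump n k).rOut ⊆ Ω) : IsTestFunction Ω fun y => mollifier n k (x - y) := by
  have hs : tsupport (fun y => mollifier n k (x - y)) ⊆ closedBall x (bump n k).rOut := by
    refine closure_minimal (fun y hy => ?_) isClosed_closedBall
    have : x - y ∈ Function.support (mollifier n k) := hy
    rw [support_mollifier, mem_ball_zero_iff] at this
    rw [mem_closedBall, dist_comm, dist_eq_norm]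
    exact this.le
  exact ⟨(contDiff_mollifier k).comp (contDiff_const.sub contDiff_id),
    HasCompactSupport.of_support_subset_isCompact (isCompact_closedBall x (bump n k).rOut)
      (subset_closure.trans hs), hs.trans hx⟩

lemma inner_gradient (φ : Euc n → ℝ) (y h : Euc n) : inner ℝ (∇ φ y) h = fderiv ℝ φ y h := by
  simp [gradient]

lemma inner_gradient_mollifier (k : ℕ) (x y h : Euc n) :
    inner ℝ (∇ (fun y => mollifier n k (x - y)) y) h = - fderiv ℝ (mollifier n k) (x - y) h := by
  rw [inner_gradient]
  have h1 : HasFDerivAt (mollifier n k) (fderiv ℝ (mollifier n k) (x - y)) (x - y) :=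
    ((contDiff_mollifier k).differentiable (by simp) _).hasFDerivAt
  have h2 : HasFDerivAt (fun y : Euc n => x - y) (-(ContinuousLinearMap.id ℝ (Euc n))) y := by
    simpa using (hasFDerivAt_id y).const_sub x
  rw [show (fun y => mollifier n k (x - y)) = mollifier n k ∘ fun y => x - y from rfl,
    (h1.comp y h2).fderiv]
  simp

lemma continuous_gradient {φ : Euc n → ℝ} (hφ : ContDiff ℝ ∞ φ) : Continuous (∇ φ) :=
  (InnerProductSpace.toDual ℝ (Euc n)).symm.continuous.comp (hφ.continuous_fderiv (by simp))

/-- Test the weak gradient with `y ↦ ρ(x - y)`, admissible because its support lies in `Ω`. The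
condition on the ball matters: the zero extension has weak gradient `G` only inside `Ω`. -/
lemma SobolevPair.fderiv_mollify {Ω : Set (Euc n)} {v : Euc n → ℝ} {G : Euc n → Euc n}
    (hv : SobolevPair Ω v G) {k : ℕ} {x : Euc n} (hx : closedBall x (bump n k).rOut ⊆ Ω)
    (h : Euc n) : fderiv ℝ (mollify k v) x h = inner ℝ (mollify k G x) h := by
  rw [(PArea.fderiv_mollify k hv.integrable.locallyIntegrable x h).2]
  have h1 := congrArg (fun z => inner ℝ z h)
    (hv.isWeakGradient _ (isTestFunction_mollifier hx))
  rw [setIntegral_eq_integral_of_forall_compl_eq_zero (fun y hy => by simp [hv.eq_zero y hy]),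
    setIntegral_eq_integral_of_forall_compl_eq_zero (fun y hy => by simp [hv.grad_eq_zero y hy]),
    ← mollify_apply] at h1
  simp only [inner_neg_left] at h1
  rw [real_inner_comm, ← integral_inner] at h1
  · rw [← neg_inj, ← h1, ← integral_neg]
    refine integral_congr_ae (Eventually.of_forall fun y => ?_)
    simp only [real_inner_comm _ h, real_inner_smul_left, inner_gradient_mollifier]
    ring
  · obtain ⟨C, hC⟩ := (isTestFunction_mollifier hx).smooth.continuous_fderiv (by simp) |>.norm
      |>.bddAbove_range_of_hasCompactSupport ((isTestFunction_mollifier hx).compactSupport.fderiv ℝ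
        |>.norm)
    refine hv.integrable.smul_bdd C
      (continuous_gradient (isTestFunction_mollifier hx).smooth).aestronglyMeasurable ?_
    refine Eventually.of_forall fun y => ?_
    have := hC (mem_range_self y)
    simpa [gradient] using this

lemma lintegral_enorm_mollify_le {V : Type*} [NormedAddCommGroup V] [NormedSpace ℝ V] (k : ℕ)
    {f : Euc n → V} (hf : Integrable f) :
    ∫⁻ x, ‖mollify k f x‖ₑ ≤ ∫⁻ x, ‖f x‖ₑ := by
  have hm : AEStronglyMeasurable
      (fun p : Euc n × Euc n => lsmul ℝ ℝ (mollifier n k p.2) (f (p.1 - p.2)))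
      (volume.prod volume) :=
    AEStronglyMeasurable.convolution_integrand _
      (continuous_mollifier k).aestronglyMeasurable hf.aestronglyMeasurable
  calc ∫⁻ x, ‖mollify k f x‖ₑ
      ≤ ∫⁻ x, ∫⁻ y, ‖mollifier n k y • f (x - y)‖ₑ := by
        refine lintegral_mono fun x => ?_
        rw [mollify_apply']
        exact enorm_integral_le_lintegral_enorm _
    _ = ∫⁻ y, ∫⁻ x, ‖mollifier n k y • f (x - y)‖ₑ := lintegral_lintegral_swap hm.enorm
    _ = ∫⁻ y, ‖mollifier n k y‖ₑ * ∫⁻ x, ‖f x‖ₑ := by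
        refine lintegral_congr fun y => ?_
        simp only [enorm_smul]
        rw [lintegral_const_mul' _ _ (by simp), lintegral_sub_right_eq_self (fun x => ‖f x‖ₑ) y]
    _ = ∫⁻ x, ‖f x‖ₑ := by
        rw [lintegral_mul_const' _ _ hf.2.ne, lintegral_mollifier, one_mul]

/-- Fundamental theorem of calculus along the segment from `x` to `x + h`. -/
lemma enorm_mollify_translate_sub_le {Ω : Set (Euc n)} {v : Euc n → ℝ} {G : Euc n → Euc n}
    (hv : SobolevPair Ω v G) {k : ℕ} {x h : Euc n}
    (hx : ∀ s ∈ Icc (0 : ℝ) 1, closedBall (x + s • h) (bump n k).rOut ⊆ Ω) :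
    ‖mollify k v (x + h) - mollify k v x‖ₑ ≤
      ∫⁻ s in Icc (0 : ℝ) 1, ‖h‖ₑ * ‖mollify k G (x + s • h)‖ₑ := by
  have hd : ∀ s : ℝ, HasDerivAt (fun s : ℝ => mollify k v (x + s • h))
      (fderiv ℝ (mollify k v) (x + s • h) h) s := fun s => by
    have h1 : HasDerivAt (fun s : ℝ => x + s • h) h s := by
      simpa using ((hasDerivAt_id s).smul_const h).const_add x
    exact (PArea.fderiv_mollify k hv.integrable.locallyIntegrable _ h).1.comp_hasDerivAt s h1
  have hc : Continuous fun s : ℝ => fderiv ℝ (mollify k v) (x + s • h) h := by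
    have := (contDiff_mollify k hv.integrable.locallyIntegrable).continuous_fderiv (by simp)
    fun_prop
  have h2 := intervalIntegral.integral_eq_sub_of_hasDerivAt (fun s _ => hd s)
    (hc.intervalIntegrable 0 1)
  simp only [one_smul, zero_smul, add_zero] at h2
  rw [← h2, intervalIntegral.integral_of_le zero_le_one, ← integral_Icc_eq_integral_Ioc]
  refine (enorm_integral_le_lintegral_enorm _).trans
    (setLIntegral_mono' measurableSet_Icc fun s hs => ?_)
  rw [hv.fderiv_mollify (hx s hs), mul_comm, ← ofReal_norm, ← ofReal_norm, ← ofReal_norm,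
    ← ENNReal.ofReal_mul (norm_nonneg _)]
  exact ENNReal.ofReal_le_ofReal (norm_inner_le_norm _ _)

/-- Compactness leaves room to mollify uniformly along all segments. The smooth estimate follows
from Tonelli and translation invariance, and Fatou removes the mollification. -/
lemma lintegral_enorm_translate_sub_le_of_isCompact {Ω : Set (Euc n)} (hΩ : IsOpen Ω)
    {v : Euc n → ℝ} {G : Euc n → Euc n} (hv : SobolevPair Ω v G) {A : Set (Euc n)}
    (hA : IsCompact A) (h : Euc n) (hAh : ∀ x ∈ A, ∀ s ∈ Icc (0 : ℝ) 1, x + s • h ∈ Ω) :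
    ∫⁻ x in A, ‖v (x + h) - v x‖ₑ ≤ ‖h‖ₑ * ∫⁻ x, ‖G x‖ₑ := by
  -- The union of the segments is a compact image of `A × [0,1]`.
  obtain ⟨δ, hδ, hsub⟩ : ∃ δ, 0 < δ ∧
      cthickening δ ((fun p : Euc n × ℝ => p.1 + p.2 • h) '' A ×ˢ Icc (0 : ℝ) 1) ⊆ Ω := by
    refine IsCompact.exists_cthickening_subset_open
      ((hA.prod isCompact_Icc).image (by fun_prop)) hΩ ?_
    rintro _ ⟨⟨x, s⟩, ⟨hx, hs⟩, rfl⟩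
    exact hAh x hx s hs
  have hev : ∀ᶠ k in atTop, (bump n k).rOut ≤ δ :=
    tendsto_bump_rOut.eventually (Iic_mem_nhds hδ)
  have hbound : ∀ᶠ k in atTop, ∫⁻ x in A, ‖mollify k v (x + h) - mollify k v x‖ₑ ≤
      ‖h‖ₑ * ∫⁻ x, ‖G x‖ₑ := by
    filter_upwards [hev] with k hk
    have hcG : Continuous (mollify k G) :=
      (contDiff_mollify k hv.integrable_grad.locallyIntegrable).continuous
    calc ∫⁻ x in A, ‖mollify k v (x + h) - mollify k v x‖ₑ
        ≤ ∫⁻ x in A, ∫⁻ s in Icc (0 : ℝ) 1, ‖h‖ₑ * ‖mollify k G (x + s • h)‖ₑ := by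
          refine setLIntegral_mono' hA.measurableSet fun x hx => ?_
          refine enorm_mollify_translate_sub_le hv fun s hs => ?_
          refine (closedBall_subset_closedBall hk).trans (Subset.trans ?_ hsub)
          exact closedBall_subset_cthickening (mem_image_of_mem (fun p : Euc n × ℝ => p.1 + p.2 • h)
            (mk_mem_prod hx hs)) δ
      _ = ∫⁻ s in Icc (0 : ℝ) 1, ∫⁻ x in A, ‖h‖ₑ * ‖mollify k G (x + s • h)‖ₑ := by
          refine lintegral_lintegral_swap ?_
          have : Continuous fun p : Euc n × ℝ => mollify k G (p.1 + p.2 • h) := by fun_prop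
          exact (this.enorm.measurable.const_mul _).aemeasurable
      _ ≤ ∫⁻ s in Icc (0 : ℝ) 1, ‖h‖ₑ * ∫⁻ x, ‖G x‖ₑ := by
          refine lintegral_mono fun s => ?_
          rw [lintegral_const_mul' _ _ (by simp)]
          refine mul_le_mul_right ((setLIntegral_le_lintegral _ _).trans ?_) _
          rw [lintegral_add_right_eq_self (fun x => ‖mollify k G x‖ₑ)]
          exact lintegral_enorm_mollify_le k hv.integrable_grad
      _ = ‖h‖ₑ * ∫⁻ x, ‖G x‖ₑ := by simp
  have hae := ae_tendsto_mollify hv.integrable.locallyIntegrable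
  have hae' : ∀ᵐ x, Tendsto (fun k => mollify k v (x + h)) atTop (𝓝 (v (x + h))) :=
    (measurePreserving_add_right volume h).quasiMeasurePreserving.ae hae
  calc ∫⁻ x in A, ‖v (x + h) - v x‖ₑ
      = ∫⁻ x in A, liminf (fun k => ‖mollify k v (x + h) - mollify k v x‖ₑ) atTop := by
        refine lintegral_congr_ae (ae_restrict_of_ae ?_)
        filter_upwards [hae, hae'] with x h1 h2
        exact ((h2.sub h1).enorm.liminf_eq).symm
    _ ≤ liminf (fun k => ∫⁻ x in A, ‖mollify k v (x + h) - mollify k v x‖ₑ) atTop := by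
        refine lintegral_liminf_le fun k => ?_
        have : Continuous (mollify k v) :=
          (contDiff_mollify k hv.integrable.locallyIntegrable).continuous
        exact (by fun_prop : Continuous fun x => ‖mollify k v (x + h) - mollify k v x‖ₑ).measurable
    _ ≤ ‖h‖ₑ * ∫⁻ x, ‖G x‖ₑ := by
        refine (liminf_le_liminf hbound).trans ?_
        simp

lemma exists_monotone_isCompact_iUnion_eq {U : Set (Euc n)} (hU : IsOpen U) :
    ∃ K : ℕ → Set (Euc n), Monotone K ∧ (∀ j, IsCompact (K j)) ∧ ⋃ j, K j = U := by
  have : LocallyCompactSpace U := hU.locallyCompactSpace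
  obtain ⟨K, hK, hKU⟩ := isSigmaCompact_iff_sigmaCompactSpace.2 (inferInstance : SigmaCompactSpace U)
  exact ⟨accumulate K, monotone_accumulate,
    fun j => (finite_Iic j).isCompact_biUnion fun i _ => hK i, by rw [iUnion_accumulate, hKU]⟩

/-- The translation estimate for Sobolev functions. -/
theorem lintegral_enorm_translate_sub_le {Ω : Set (Euc n)} (hΩ : IsOpen Ω)
    {v : Euc n → ℝ} {G : Euc n → Euc n} (hv : SobolevPair Ω v G) {A : Set (Euc n)}
    (h : Euc n) (hAh : ∀ x ∈ A, ∀ s ∈ Icc (0 : ℝ) 1, x + s • h ∈ Ω) :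
    ∫⁻ x in A, ‖v (x + h) - v x‖ₑ ≤ ‖h‖ₑ * ∫⁻ x, ‖G x‖ₑ := by
  let U : Set (Euc n) := {x | ∀ s ∈ Icc (0 : ℝ) 1, x + s • h ∈ Ω}
  have hU : IsOpen U := by
    have h1 : IsOpen ((fun p : Euc n × ℝ => p.1 + p.2 • h) ⁻¹' Ω) := hΩ.preimage (by fun_prop)
    refine isOpen_iff_mem_nhds.2 fun x hx => ?_
    refine (isCompact_Icc.eventually_forall_of_forall_eventually (x₀ := x)
      (P := fun x s => x + s • h ∈ Ω) fun s hs => h1.mem_nhds (hx s hs))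
  -- `A` need not be measurable: it is enlarged to the open set `U` of all admissible points, which
  -- compact sets exhaust.
  obtain ⟨K, hKm, hKc, hKU⟩ := exists_monotone_isCompact_iUnion_eq hU
  refine (lintegral_mono_set (show A ⊆ ⋃ j, K j from hKU ▸ hAh)).trans ?_
  rw [setLIntegral_iUnion_of_directed _ hKm.directed_le]
  exact iSup_le fun j => lintegral_enorm_translate_sub_le_of_isCompact hΩ hv (hKc j) h
    fun x hx => (hKU ▸ mem_iUnion_of_mem j hx : x ∈ U)

end Mollification

/-! ### The Poincaré inequality on a bounded Lipschitz domain -/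

section Poincare

variable {n : ℕ} {Ω : Set (Euc n)}

/-- Moving along `e` keeps the projection to `e^⊥` and raises the height, so points of `Ω` stay
above the graph. After moving by `t` they lie at least `t` above it. This is a closed condition, so
even the closure of the moved patch avoids the boundary. -/
lemma exists_boundary_patch (hlip : HasLipschitzBoundary Ω) {x : Euc n} (hx : x ∈ frontier Ω) :
    ∃ (e : Euc n) (r t₀ : ℝ), ‖e‖ = 1 ∧ 0 < r ∧ 0 < t₀ ∧ ∀ t, 0 < t → t ≤ t₀ →
      (∀ y ∈ Ω ∩ ball x r, ∀ s ∈ Icc (0 : ℝ) 1, y + s • (t • e) ∈ Ω) ∧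
      closure ((fun y => y + t • e) '' (Ω ∩ ball x r)) ⊆ Ω := by
  obtain ⟨e, γ, K, r, he, hγ, hr, hΩ⟩ := hlip x hx
  have hee : inner ℝ e e = 1 := by rw [real_inner_self_eq_norm_sq, he]; norm_num
  have hmem : ∀ y ∈ ball x r, (y ∈ Ω ↔ γ (y - (inner ℝ e y) • e) < inner ℝ e y) := fun y hy => by
    have := Set.ext_iff.1 hΩ y
    simpa [hy] using this
  have hproj : ∀ (y : Euc n) (t : ℝ),
      (y + t • e) - (inner ℝ e (y + t • e)) • e = y - (inner ℝ e y) • e := fun y t => by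
    rw [inner_add_right, real_inner_smul_right, hee]
    module
  have hinner : ∀ (y : Euc n) (t : ℝ), inner ℝ e (y + t • e) = inner ℝ e y + t := fun y t => by
    rw [inner_add_right, real_inner_smul_right, hee, mul_one]
  have hball : ∀ y ∈ ball x (r / 2), ∀ t, 0 ≤ t → t ≤ r / 4 →
      y + t • e ∈ closedBall x (3 * r / 4) := fun y hy t ht htr => by
    rw [mem_closedBall, dist_eq_norm, add_sub_right_comm]
    rw [mem_ball, dist_eq_norm] at hy
    have h1 := norm_add_le (y - x) (t • e)
    rw [norm_smul, he, mul_one, Real.norm_of_nonneg ht] at h1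
    linarith
  have hsub : closedBall x (3 * r / 4) ⊆ ball x r := closedBall_subset_ball (by linarith)
  -- Points of the half ball moved by at most `r / 4` stay in the closed ball of radius `3 * r / 4`,
  -- inside the ball where the graph describes `Ω`.
  refine ⟨e, r / 2, r / 4, he, by positivity, by positivity, fun t ht htr => ⟨?_, ?_⟩⟩
  · rintro y ⟨hy, hyb⟩ s ⟨hs0, hs1⟩
    rw [smul_smul]
    have hst : 0 ≤ s * t := by positivity
    have hst' : s * t ≤ r / 4 := (mul_le_of_le_one_left ht.le hs1).trans htr
    rw [hmem _ (hsub (hball y hyb _ hst hst')), hproj, hinner]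
    have := (hmem y (ball_subset_ball (by linarith) hyb)).1 hy
    linarith
  · have hc : IsClosed {z : Euc n | z ∈ closedBall x (3 * r / 4) ∧
        γ (z - (inner ℝ e z) • e) ≤ inner ℝ e z - t} := by
      have h1 : Continuous fun z : Euc n => γ (z - (inner ℝ e z) • e) :=
        hγ.continuous.comp (by fun_prop)
      have h2 : Continuous fun z : Euc n => inner ℝ e z - t := by fun_prop
      exact isClosed_closedBall.inter (isClosed_le h1 h2)
    refine (closure_minimal ?_ hc).trans ?_
    · rintro _ ⟨y, ⟨hy, hyb⟩, rfl⟩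
      refine ⟨hball y hyb t ht.le htr, ?_⟩
      rw [hproj, hinner]
      have := (hmem y (ball_subset_ball (by linarith) hyb)).1 hy
      linarith
    · rintro z ⟨hz, hzt⟩
      rw [hmem z (hsub hz)]
      linarith

/-- A property of sets that is stable under subsets and finite unions holds for a bounded Lipschitz
domain if it holds for its compact subsets and can be pulled back along small translations into the
domain. -/
lemma lipschitz_domain_induction (hΩ : IsOpen Ω) (hb : Bornology.IsBounded Ω)
    (hlip : HasLipschitzBoundary Ω) {P : Set (Euc n) → Prop} (hempty : P ∅)
    (hmono : ∀ A B, A ⊆ B → P B → P A) (hunion : ∀ A B, P A → P B → P (A ∪ B))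
    (hcompact : ∀ K ⊆ Ω, IsCompact K → P K)
    (hstep : ∀ (A : Set (Euc n)) (e : Euc n) (t₀ : ℝ), ‖e‖ = 1 → 0 < t₀ →
      (∀ t, 0 < t → t ≤ t₀ → (∀ y ∈ A, ∀ s ∈ Icc (0 : ℝ) 1, y + s • (t • e) ∈ Ω) ∧
        P ((fun y => y + t • e) '' A)) → P A) : P Ω := by
  have hcl : IsCompact (closure Ω) := hb.isCompact_closure
  have key : P (closure Ω ∩ Ω) := by
    refine hcl.induction_on (p := fun s => P (s ∩ Ω)) (by simpa using hempty)
      (fun s t hst ht => hmono _ _ (inter_subset_inter_left _ hst) ht)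
      (fun s t hs ht => by rw [union_inter_distrib_right]; exact hunion _ _ hs ht) fun x hx => ?_
    by_cases hxΩ : x ∈ Ω
    · obtain ⟨K, hK, hxK, hKΩ⟩ := exists_compact_subset hΩ hxΩ
      exact ⟨K, mem_nhdsWithin_of_mem_nhds (mem_interior_iff_mem_nhds.1 hxK),
        hmono _ _ inter_subset_left (hcompact K hKΩ hK)⟩
    · have hxf : x ∈ frontier Ω := by rw [hΩ.frontier_eq]; exact ⟨hx, hxΩ⟩
      obtain ⟨e, r, t₀, he, hr, ht₀, h⟩ := exists_boundary_patch hlip hxf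
      refine ⟨ball x r, mem_nhdsWithin_of_mem_nhds (ball_mem_nhds x hr), ?_⟩
      rw [inter_comm]
      refine hstep _ e t₀ he ht₀ fun t ht htt => ⟨(h t ht htt).1, ?_⟩
      refine hmono _ _ subset_closure (hcompact _ (h t ht htt).2 ?_)
      have hb' : Bornology.IsBounded ((fun y => y + t • e) '' (Ω ∩ ball x r)) :=
        (IsometryEquiv.addRight (t • e)).isometry.lipschitz.isBounded_image
          (hb.subset inter_subset_left)
      exact hb'.isCompact_closure
  exact hmono _ _ (subset_inter subset_closure Subset.rfl) key

lemma lintegral_image_add_right (h : Euc n) (A : Set (Euc n)) (f : Euc n → ℝ≥0∞) :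
    ∫⁻ x in A, f (x + h) = ∫⁻ x in (fun y => y + h) '' A, f x :=
  (measurePreserving_add_right volume h).setLIntegral_comp_emb
    (MeasurableEquiv.addRight h).measurableEmbedding f A

/-- Triangle inequality through `v (x + h)`. The constant `c` is free: the Poincaré argument takes a
mean value, the Rellich argument takes `0`. -/
lemma SobolevPair.lintegral_le_translate (hΩ : IsOpen Ω) {v : Euc n → ℝ} {G : Euc n → Euc n}
    (hv : SobolevPair Ω v G) {A : Set (Euc n)} (h : Euc n) (c : ℝ)
    (hAh : ∀ x ∈ A, ∀ s ∈ Icc (0 : ℝ) 1, x + s • h ∈ Ω) :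
    ∫⁻ x in A, ‖v x - c‖ₑ ≤
      (∫⁻ x in (fun y => y + h) '' A, ‖v x - c‖ₑ) + ‖h‖ₑ * ∫⁻ x, ‖G x‖ₑ := by
  have hm := hv.measurable
  calc ∫⁻ x in A, ‖v x - c‖ₑ
      ≤ ∫⁻ x in A, ‖v (x + h) - c‖ₑ + ‖v (x + h) - v x‖ₑ := by
        refine lintegral_mono fun x => ?_
        have : v x - c = (v (x + h) - c) - (v (x + h) - v x) := by ring
        rw [this]
        exact enorm_sub_le
    _ = (∫⁻ x in A, ‖v (x + h) - c‖ₑ) + ∫⁻ x in A, ‖v (x + h) - v x‖ₑ :=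
        lintegral_add_left (by fun_prop : Measurable fun x => ‖v (x + h) - c‖ₑ) _
    _ ≤ _ := by
        rw [← lintegral_image_add_right h A fun x => ‖v x - c‖ₑ]
        gcongr
        exact lintegral_enorm_translate_sub_le hΩ hv h hAh

/-- The deviation from the mean is at most the mean of `|v x - v y|` over `y`. With `y = x + h` only
`|h| < 2ρ` contributes, segments stay in the ball by convexity, and the translation estimate bounds
the integral for each `h`. -/
lemma SobolevPair.lintegral_ball_sub_average_le (hΩ : IsOpen Ω) {v : Euc n → ℝ}
    {G : Euc n → Euc n} (hv : SobolevPair Ω v G) {a : Euc n} {ρ : ℝ} (hρ : 0 < ρ)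
    (hB : ball a ρ ⊆ Ω) :
    ∫⁻ x in ball a ρ, ‖v x - ⨍ y in ball a ρ, v y‖ₑ ≤
      (volume (ball a ρ))⁻¹ * (volume (ball (0 : Euc n) (2 * ρ)) * ENNReal.ofReal (2 * ρ)) *
        ∫⁻ x, ‖G x‖ₑ := by
  set B := ball a ρ with hBdef
  have hm := hv.measurable
  have hB0 : volume B ≠ 0 := (measure_ball_pos volume a hρ).ne'
  have hBt : volume B ≠ ⊤ := measure_ball_lt_top.ne
  have hfin : IsFiniteMeasure (volume.restrict B) := ⟨by simpa using hBt.lt_top⟩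
  have h1 : ∀ x, ‖v x - ⨍ y in B, v y‖ₑ ≤ (volume B)⁻¹ * ∫⁻ y in B, ‖v x - v y‖ₑ := fun x => by
    have : v x - ⨍ y in B, v y = ⨍ y in B, (v x - v y) := by
      rw [average_eq, average_eq, integral_sub (integrable_const _) hv.integrable.integrableOn,
        integral_const, smul_sub, smul_smul, inv_mul_cancel₀, one_smul]
      simpa [measureReal_def, ENNReal.toReal_eq_zero_iff] using ⟨hB0, hBt⟩
    rw [this, average_eq, enorm_smul]
    refine mul_le_mul' (le_of_eq ?_) (enorm_integral_le_lintegral_enorm _)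
    rw [measureReal_restrict_apply_univ, measureReal_def, enorm_inv, Real.enorm_of_nonneg,
      ENNReal.ofReal_toReal hBt]
    · exact ENNReal.toReal_nonneg
    · simpa [ENNReal.toReal_eq_zero_iff] using ⟨hB0, hBt⟩
  have h2 : ∀ h : Euc n, ∫⁻ x in B, B.indicator (fun y => ‖v x - v y‖ₑ) (x + h) ≤
      (ball (0 : Euc n) (2 * ρ)).indicator
        (fun _ => ENNReal.ofReal (2 * ρ) * ∫⁻ x, ‖G x‖ₑ) h := fun h => by
    by_cases hh : h ∈ ball (0 : Euc n) (2 * ρ)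
    · rw [indicator_of_mem hh]
      calc ∫⁻ x in B, B.indicator (fun y => ‖v x - v y‖ₑ) (x + h)
          = ∫⁻ x in B, ((fun x => x + h) ⁻¹' B).indicator (fun x => ‖v (x + h) - v x‖ₑ) x := by
            refine lintegral_congr fun x => ?_
            by_cases hx : x + h ∈ B
            · rw [indicator_of_mem hx, indicator_of_mem (show x ∈ (fun x => x + h) ⁻¹' B from hx),
                enorm_sub_rev]
            · rw [indicator_of_notMem hx,
                indicator_of_notMem (show x ∉ (fun x => x + h) ⁻¹' B from hx)]
        _ = ∫⁻ x in (fun x => x + h) ⁻¹' B ∩ B, ‖v (x + h) - v x‖ₑ := by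
            rw [setLIntegral_indicator (measurableSet_ball.preimage (by fun_prop))]
        _ ≤ ‖h‖ₑ * ∫⁻ x, ‖G x‖ₑ := by
            refine lintegral_enorm_translate_sub_le hΩ hv h fun x hx s hs => hB ?_
            have := (convex_ball a ρ).add_smul_sub_mem hx.2 hx.1 hs
            rwa [add_sub_cancel_left] at this
        _ ≤ _ := by
            gcongr
            rw [← ofReal_norm]
            exact ENNReal.ofReal_le_ofReal (mem_ball_zero_iff.1 hh).le
    · rw [indicator_of_notMem hh]
      refine (setLIntegral_mono' (g := fun _ => 0) measurableSet_ball fun x hx => ?_).trans (by simp)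
      rw [indicator_of_notMem fun hxh => hh ?_]
      rw [mem_ball_zero_iff]
      have h3 := dist_triangle_right (x + h) x a
      rw [dist_eq_norm, add_sub_cancel_left] at h3
      have h4 : dist (x + h) a < ρ := hxh
      have h5 : dist x a < ρ := hx
      linarith
  calc ∫⁻ x in B, ‖v x - ⨍ y in B, v y‖ₑ
      ≤ ∫⁻ x in B, (volume B)⁻¹ * ∫⁻ y in B, ‖v x - v y‖ₑ := lintegral_mono h1
    _ = (volume B)⁻¹ * ∫⁻ x in B, ∫⁻ y in B, ‖v x - v y‖ₑ :=
        lintegral_const_mul' _ _ (ENNReal.inv_ne_top.2 hB0)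
    _ = (volume B)⁻¹ * ∫⁻ x in B, ∫⁻ h, B.indicator (fun y => ‖v x - v y‖ₑ) (x + h) := by
        congr 1
        refine lintegral_congr fun x => ?_
        rw [lintegral_add_left_eq_self (fun z => B.indicator (fun y => ‖v x - v y‖ₑ) z) x,
          lintegral_indicator measurableSet_ball]
    _ = (volume B)⁻¹ * ∫⁻ h, ∫⁻ x in B, B.indicator (fun y => ‖v x - v y‖ₑ) (x + h) := by
        rw [lintegral_lintegral_swap]
        have hmeas : Measurable fun p : Euc n × Euc n =>
            ((fun p : Euc n × Euc n => p.1 + p.2) ⁻¹' B).indicator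
              (fun p => ‖v p.1 - v (p.1 + p.2)‖ₑ) p :=
          Measurable.indicator (by fun_prop) (measurableSet_ball.preimage (by fun_prop))
        exact hmeas.aemeasurable
    _ ≤ (volume B)⁻¹ * ∫⁻ h, (ball (0 : Euc n) (2 * ρ)).indicator
        (fun _ => ENNReal.ofReal (2 * ρ) * ∫⁻ x, ‖G x‖ₑ) h := by
        gcongr with h
        exact h2 h
    _ = _ := by
        rw [lintegral_indicator measurableSet_ball, setLIntegral_const]
        ring

/-- `A` satisfies a Poincaré inequality with the mean value over the reference set `B`. -/
def PoincareSet (Ω B A : Set (Euc n)) : Prop :=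
  ∃ C : ℝ≥0, ∀ v G, SobolevPair Ω v G →
    ∫⁻ x in A, ‖v x - ⨍ y in B, v y‖ₑ ≤ C * ∫⁻ x, ‖G x‖ₑ

lemma PoincareSet.mono {B A A' : Set (Euc n)} (h : PoincareSet Ω B A) (hA : A' ⊆ A) :
    PoincareSet Ω B A' := by
  obtain ⟨C, hC⟩ := h
  exact ⟨C, fun v G hv => (lintegral_mono_set hA).trans (hC v G hv)⟩

lemma PoincareSet.empty (B : Set (Euc n)) : PoincareSet Ω B ∅ := ⟨0, by simp⟩

lemma PoincareSet.union {B A A' : Set (Euc n)} (h : PoincareSet Ω B A) (h' : PoincareSet Ω B A') :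
    PoincareSet Ω B (A ∪ A') := by
  obtain ⟨C, hC⟩ := h
  obtain ⟨C', hC'⟩ := h'
  refine ⟨C + C', fun v G hv => (lintegral_union_le _ _ _).trans ?_⟩
  rw [ENNReal.coe_add, add_mul]
  exact add_le_add (hC v G hv) (hC' v G hv)

lemma PoincareSet.of_translate (hΩ : IsOpen Ω) {B A : Set (Euc n)} (h : Euc n)
    (hAh : ∀ x ∈ A, ∀ s ∈ Icc (0 : ℝ) 1, x + s • h ∈ Ω)
    (hA : PoincareSet Ω B ((fun y => y + h) '' A)) : PoincareSet Ω B A := by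
  obtain ⟨C, hC⟩ := hA
  refine ⟨C + ‖h‖₊, fun v G hv => (hv.lintegral_le_translate hΩ h _ hAh).trans ?_⟩
  rw [ENNReal.coe_add, add_mul]
  exact add_le_add (hC v G hv) le_rfl

/-- The reference ball is kept fixed, and the set of centres having a good ball is open and
relatively closed in the connected set `Ω`. A good ball near `a` is carried to `a` by one
translation. -/
lemma exists_ball_poincareSet (hΩ : IsOpen Ω) (hconn : IsConnected Ω) :
    ∃ B : Set (Euc n), B ⊆ Ω ∧ MeasurableSet B ∧ ∀ a ∈ Ω, ∃ r > 0, PoincareSet Ω B (ball a r) := by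
  obtain ⟨a₀, ha₀⟩ := hconn.nonempty
  obtain ⟨ρ, hρ, hB⟩ := Metric.isOpen_iff.1 hΩ a₀ ha₀
  refine ⟨ball a₀ ρ, hB, measurableSet_ball, ?_⟩
  have hbase : PoincareSet Ω (ball a₀ ρ) (ball a₀ ρ) := by
    refine ⟨((volume (ball a₀ ρ))⁻¹ *
      (volume (ball (0 : Euc n) (2 * ρ)) * ENNReal.ofReal (2 * ρ))).toNNReal, fun v G hv => ?_⟩
    rw [ENNReal.coe_toNNReal]
    · exact hv.lintegral_ball_sub_average_le hΩ hρ hB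
    · exact ENNReal.mul_ne_top (ENNReal.inv_ne_top.2 (measure_ball_pos volume a₀ hρ).ne')
        (ENNReal.mul_ne_top measure_ball_lt_top.ne ENNReal.ofReal_ne_top)
  let S : Set (Euc n) := {a | ∃ r > 0, PoincareSet Ω (ball a₀ ρ) (ball a r)}
  have hS : IsOpen S := by
    refine Metric.isOpen_iff.2 fun a ⟨r, hr, h⟩ => ⟨r / 2, by positivity, fun b hb => ?_⟩
    refine ⟨r / 2, by positivity, h.mono (ball_subset_ball' ?_)⟩
    rw [mem_ball] at hb
    linarith
  refine hconn.isPreconnected.subset_of_closure_inter_subset hS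
    ⟨a₀, ha₀, ρ, hρ, hbase⟩ fun a ⟨haS, haΩ⟩ => ?_
  obtain ⟨r, hr, hra⟩ := Metric.isOpen_iff.1 hΩ a haΩ
  obtain ⟨b, ⟨s, hs, hbs⟩, hab⟩ := Metric.mem_closure_iff.1 haS (r / 2) (by positivity)
  -- Radius at most `s`, so that translating by `b - a` lands in the good ball. Radius at most `r /
  -- 2`, so that with `|b - a| < r / 2` the segments stay in `ball a r`.
  refine ⟨min s (r / 2), by positivity, ?_⟩
  refine PoincareSet.of_translate hΩ (b - a) (fun x hx t ht => hra ?_) (hbs.mono ?_)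
  · rw [mem_ball, dist_eq_norm] at hx ⊢
    rw [dist_eq_norm, ← norm_neg, neg_sub] at hab
    have h1 := norm_add_le (x - a) (t • (b - a))
    rw [norm_smul, Real.norm_of_nonneg ht.1] at h1
    have h2 : t * ‖b - a‖ ≤ ‖b - a‖ := mul_le_of_le_one_left (norm_nonneg _) ht.2
    have h3 := min_le_right s (r / 2)
    rw [add_sub_right_comm]
    linarith
  · rintro _ ⟨x, hx, rfl⟩
    rw [mem_ball, dist_eq_norm] at hx ⊢
    have h3 := min_le_left s (r / 2)
    have : x + (b - a) - b = x - a := by abel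
    rw [this]
    linarith

/-- The Poincaré inequality on a bounded Lipschitz domain, with the mean value over a subset. -/
theorem exists_poincareSet (hΩ : IsOpen Ω) (hconn : IsConnected Ω) (hb : Bornology.IsBounded Ω)
    (hlip : HasLipschitzBoundary Ω) : ∃ B ⊆ Ω, PoincareSet Ω B Ω := by
  obtain ⟨B, hB, -, hball⟩ := exists_ball_poincareSet hΩ hconn
  refine ⟨B, hB, lipschitz_domain_induction hΩ hb hlip (PoincareSet.empty B)
    (fun _ _ hA h => h.mono hA) (fun _ _ => PoincareSet.union) (fun K hKΩ hK => ?_) ?_⟩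
  · refine hK.induction_on (PoincareSet.empty B) (fun _ _ hA h => h.mono hA)
      (fun _ _ => PoincareSet.union) fun x hx => ?_
    obtain ⟨r, hr, h⟩ := hball x (hKΩ hx)
    exact ⟨ball x r, mem_nhdsWithin_of_mem_nhds (ball_mem_nhds x hr), h⟩
  -- A single translation, by `t₀`, suffices: its length is absorbed in the constant.
  · intro A e t₀ _ ht₀ h
    exact PoincareSet.of_translate hΩ _ (h t₀ ht₀ le_rfl).1 (h t₀ ht₀ le_rfl).2

/-- A function in `H¹(Ω)`, extended by zero. -/
lemma HasH1Gradient.exists_sobolevPair (hΩ : IsOpen Ω) (hb : Bornology.IsBounded Ω)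
    {v : Euc n → ℝ} {G : Euc n → Euc n} (hv : HasH1Gradient Ω v G) :
    ∃ v' G', SobolevPair Ω v' G' ∧ v' =ᵐ[volume.restrict Ω] v ∧ G' =ᵐ[volume.restrict Ω] G := by
  have hfin : IsFiniteMeasure (volume.restrict Ω) := ⟨by simpa using hb.measure_lt_top⟩
  have hm := hΩ.measurableSet
  have h1 : Ω.indicator (hv.memLp.1.mk v) =ᵐ[volume.restrict Ω] v :=
    (indicator_ae_eq_restrict hm).trans hv.memLp.1.ae_eq_mk.symm
  have h2 : Ω.indicator G =ᵐ[volume.restrict Ω] G := indicator_ae_eq_restrict hm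
  refine ⟨Ω.indicator (hv.memLp.1.mk v), Ω.indicator G, ⟨?_, ?_, ?_, ?_, ?_, ?_⟩, h1, h2⟩
  · exact hv.memLp.1.stronglyMeasurable_mk.measurable.indicator hm
  · rw [integrable_indicator_iff hm]
    exact (hv.memLp.integrable one_le_two).congr hv.memLp.1.ae_eq_mk
  · rw [integrable_indicator_iff hm]
    exact hv.memLp_grad.integrable one_le_two
  · exact fun x hx => indicator_of_notMem hx _
  · exact fun x hx => indicator_of_notMem hx _
  · intro φ hφ
    rw [integral_congr_ae (h1.smul (ae_eq_refl (∇ φ))), hv.isWeakGradient φ hφ]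
    congr 1
    exact integral_congr_ae ((ae_eq_refl φ).smul h2.symm)

/-- The Poincaré inequality for functions of mean zero. -/
theorem exists_poincare_constant (hΩ : IsOpen Ω) (hconn : IsConnected Ω)
    (hb : Bornology.IsBounded Ω) (hlip : HasLipschitzBoundary Ω) :
    ∃ C : ℝ, 0 < C ∧ ∀ v G, HasH1Gradient Ω v G → ∫ x in Ω, v x = 0 →
      ∫ x in Ω, ‖v x‖ ≤ C * ∫ x in Ω, ‖G x‖ := by
  obtain ⟨B, hB, C, hC⟩ := exists_poincareSet hΩ hconn hb hlip
  -- As `v'` has mean zero, `∫ |c| = |∫ (v' - c)| ≤ ∫ |v' - c|`, so replacing the mean over `B` by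
  -- `0` costs a factor two. The `+ 1` only makes the constant positive.
  refine ⟨2 * (C + 1), by positivity, fun v G hvG hv0 => ?_⟩
  have hfin : IsFiniteMeasure (volume.restrict Ω) := ⟨by simpa using hb.measure_lt_top⟩
  obtain ⟨v', G', hp, hv', hG'⟩ := hvG.exists_sobolevPair hΩ hb
  set c := ⨍ y in B, v' y
  have hi : Integrable v' (volume.restrict Ω) := hp.integrable.restrict
  have hic : Integrable (fun x => v' x - c) (volume.restrict Ω) := hi.sub (integrable_const c)
  have hI : ∫ x in Ω, ‖v' x - c‖ ≤ C * ∫ x in Ω, ‖G x‖ := by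
    have h1 := hC v' G' hp
    have h2 : ∫⁻ x, ‖G' x‖ₑ = ∫⁻ x in Ω, ‖G' x‖ₑ := by
      rw [← lintegral_indicator hΩ.measurableSet]
      refine lintegral_congr fun x => ?_
      by_cases hx : x ∈ Ω
      · rw [indicator_of_mem hx]
      · rw [indicator_of_notMem hx, hp.grad_eq_zero x hx, enorm_zero]
    rw [integral_norm_eq_lintegral_enorm hic.1,
      ← show ∫ x in Ω, ‖G' x‖ = ∫ x in Ω, ‖G x‖ from
        integral_congr_ae (EventuallyEq.fun_comp hG' norm), integral_norm_eq_lintegral_enorm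
      hp.integrable_grad.restrict.1, ← h2]
    have h3 := ENNReal.toReal_mono (ENNReal.mul_ne_top ENNReal.coe_ne_top
      hp.integrable_grad.2.ne) h1
    simpa using h3
  have hG0 : 0 ≤ ∫ x in Ω, ‖G x‖ := integral_nonneg fun _ => norm_nonneg _
  have h0 : ∫ x in Ω, v' x = 0 := by rw [integral_congr_ae hv', hv0]
  have hconst : ∫ x in Ω, ‖c‖ ≤ ∫ x in Ω, ‖v' x - c‖ := by
    have h1 : ∫ x in Ω, (v' x - c) = - ∫ _ in Ω, c := by
      rw [integral_sub hi (integrable_const _), h0, zero_sub]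
    calc ∫ x in Ω, ‖c‖ = ‖∫ x in Ω, (v' x - c)‖ := by
          rw [h1, norm_neg, integral_const, integral_const, norm_smul, smul_eq_mul,
            Real.norm_of_nonneg measureReal_nonneg]
      _ ≤ _ := norm_integral_le_integral_norm _
  calc ∫ x in Ω, ‖v x‖ = ∫ x in Ω, ‖v' x‖ := integral_congr_ae
        (EventuallyEq.fun_comp hv' norm).symm
    _ ≤ ∫ x in Ω, (‖v' x - c‖ + ‖c‖) := by
        refine integral_mono hi.norm (hic.norm.add (integrable_const _)) fun x => ?_
        simpa using norm_add_le (v' x - c) c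
    _ = (∫ x in Ω, ‖v' x - c‖) + ∫ x in Ω, ‖c‖ :=
        integral_add hic.norm (integrable_const _)
    _ ≤ 2 * (C + 1) * ∫ x in Ω, ‖G x‖ := by nlinarith

end Poincare

/-! ### Rellich compactness in `W^{1,1}` along an ultrafilter -/

section Rellich

variable {n : ℕ} {Ω : Set (Euc n)}

lemma IsTestFunction.exists_bound {φ : Euc n → ℝ} (hφ : IsTestFunction Ω φ) :
    ∃ C, 0 ≤ C ∧ ∀ x, ‖φ x‖ ≤ C := by
  obtain ⟨C, hC⟩ := hφ.compactSupport.exists_bound_of_continuous hφ.smooth.continuous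
  exact ⟨C, (norm_nonneg _).trans (hC 0), hC⟩

lemma IsTestFunction.exists_gradient_bound {φ : Euc n → ℝ} (hφ : IsTestFunction Ω φ) :
    ∃ C, 0 ≤ C ∧ ∀ x, ‖∇ φ x‖ ≤ C := by
  obtain ⟨C, hC⟩ := (hφ.compactSupport.fderiv ℝ).exists_bound_of_continuous
    (hφ.smooth.continuous_fderiv (by simp))
  have h : ∀ x, ‖∇ φ x‖ ≤ C := fun x => by simpa [gradient] using hC x
  exact ⟨C, (norm_nonneg _).trans (h 0), h⟩

lemma IsTestFunction.continuous_gradient {φ : Euc n → ℝ} (hφ : IsTestFunction Ω φ) :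
    Continuous (∇ φ) := PArea.continuous_gradient hφ.smooth

lemma IsTestFunction.integrable_smul_gradient {φ u : Euc n → ℝ} (hφ : IsTestFunction Ω φ)
    {μ : Measure (Euc n)} (hu : Integrable u μ) : Integrable (fun x => u x • ∇ φ x) μ := by
  obtain ⟨C, -, hC⟩ := hφ.exists_gradient_bound
  exact hu.smul_bdd C hφ.continuous_gradient.aestronglyMeasurable (Eventually.of_forall hC)

lemma IsTestFunction.integrable_smul {V : Type*} [NormedAddCommGroup V] [NormedSpace ℝ V]
    {φ : Euc n → ℝ} {G : Euc n → V} (hφ : IsTestFunction Ω φ)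
    {μ : Measure (Euc n)} (hG : Integrable G μ) : Integrable (fun x => φ x • G x) μ := by
  obtain ⟨C, -, hC⟩ := hφ.exists_bound
  exact hG.bdd_smul C hφ.smooth.continuous.aestronglyMeasurable (Eventually.of_forall hC)

lemma IsWeakGradient.add {u v : Euc n → ℝ} {G G' : Euc n → Euc n}
    (hu : IsWeakGradient Ω u G) (hv : IsWeakGradient Ω v G')
    (hui : IntegrableOn u Ω) (hvi : IntegrableOn v Ω) (hG : IntegrableOn G Ω)
    (hG' : IntegrableOn G' Ω) : IsWeakGradient Ω (u + v) (G + G') := fun φ hφ => by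
  simp only [Pi.add_apply, add_smul, smul_add]
  rw [integral_add (hφ.integrable_smul_gradient hui) (hφ.integrable_smul_gradient hvi),
    integral_add (hφ.integrable_smul hG) (hφ.integrable_smul hG'), hu φ hφ, hv φ hφ, neg_add]

lemma IsWeakGradient.const_smul {u : Euc n → ℝ} {G : Euc n → Euc n}
    (hu : IsWeakGradient Ω u G) (c : ℝ) : IsWeakGradient Ω (c • u) (c • G) := fun φ hφ => by
  simp only [Pi.smul_apply, smul_assoc, smul_comm _ c]
  rw [integral_smul, integral_smul, hu φ hφ, smul_neg]

lemma SobolevPair.sub {u v : Euc n → ℝ} {G G' : Euc n → Euc n} (hu : SobolevPair Ω u G)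
    (hv : SobolevPair Ω v G') : SobolevPair Ω (u - v) (G - G') where
  measurable := hu.measurable.sub hv.measurable
  integrable := hu.integrable.sub hv.integrable
  integrable_grad := hu.integrable_grad.sub hv.integrable_grad
  eq_zero x hx := by simp [hu.eq_zero x hx, hv.eq_zero x hx]
  grad_eq_zero x hx := by simp [hu.grad_eq_zero x hx, hv.grad_eq_zero x hx]
  isWeakGradient := by
    have h1 := hv.isWeakGradient.const_smul (-1)
    have h2 := hu.isWeakGradient.add h1 hu.integrable.integrableOn
      (hv.integrable.smul (-1 : ℝ)).integrableOn
      hu.integrable_grad.integrableOn (hv.integrable_grad.smul (-1 : ℝ)).integrableOn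
    simpa [sub_eq_add_neg] using h2

/-- Mollification averages translates by vectors shorter than `rOut`, each controlled by the
translation estimate. The bound depends on `v` only through the mass of its gradient. -/
lemma SobolevPair.lintegral_mollify_sub_le (hΩ : IsOpen Ω) {v : Euc n → ℝ} {G : Euc n → Euc n}
    (hv : SobolevPair Ω v G) {K : Set (Euc n)} {k : ℕ}
    (hKk : cthickening (bump n k).rOut K ⊆ Ω) :
    ∫⁻ x in K, ‖mollify k v x - v x‖ₑ ≤ ENNReal.ofReal (bump n k).rOut * ∫⁻ x, ‖G x‖ₑ := by
  have hm := hv.measurable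
  have hmol := (continuous_mollifier (n := n) k).measurable
  have h1 : ∀ x, ‖mollify k v x - v x‖ₑ ≤ ∫⁻ y, ‖mollifier n k y‖ₑ * ‖v (x + -y) - v x‖ₑ :=
      fun x => by
    have h2 : Integrable fun y => mollifier n k y • v (x - y) := by
      have := (integrable_mollifier_smul k hv.integrable.locallyIntegrable x).comp_sub_left x
      simpa using this
    have h3 : mollify k v x - v x = ∫ y, mollifier n k y • (v (x + -y) - v x) := by
      simp only [smul_sub, ← sub_eq_add_neg]
      rw [integral_sub h2 ((integrable_mollifier k).smul_const _), integral_smul_const,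
        integral_mollifier, one_smul, mollify_apply']
    rw [h3]
    refine (enorm_integral_le_lintegral_enorm _).trans (le_of_eq ?_)
    simp only [enorm_smul]
  calc ∫⁻ x in K, ‖mollify k v x - v x‖ₑ
      ≤ ∫⁻ x in K, ∫⁻ y, ‖mollifier n k y‖ₑ * ‖v (x + -y) - v x‖ₑ := lintegral_mono h1
    _ = ∫⁻ y, ∫⁻ x in K, ‖mollifier n k y‖ₑ * ‖v (x + -y) - v x‖ₑ := by
        refine lintegral_lintegral_swap ?_
        exact Measurable.aemeasurable (by fun_prop)
    _ ≤ ∫⁻ y, ‖mollifier n k y‖ₑ * (ENNReal.ofReal (bump n k).rOut * ∫⁻ x, ‖G x‖ₑ) := by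
        refine lintegral_mono fun y => ?_
        rw [lintegral_const_mul' _ _ (by simp)]
        by_cases hy : mollifier n k y = 0
        · simp [hy]
        have hyr : ‖y‖ < (bump n k).rOut := by
          have : y ∈ Function.support (mollifier n k) := hy
          rwa [support_mollifier, mem_ball_zero_iff] at this
        refine mul_le_mul_right ((lintegral_enorm_translate_sub_le hΩ hv (-y)
          fun x hx s hs => hKk ?_).trans ?_) _
        · refine closedBall_subset_cthickening hx _ ?_
          rw [mem_closedBall, dist_eq_norm, add_sub_cancel_left, norm_smul, norm_neg,
            Real.norm_of_nonneg hs.1]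
          exact (mul_le_of_le_one_left (norm_nonneg _) hs.2).trans hyr.le
        · gcongr
          rw [enorm_neg, ← ofReal_norm]
          exact ENNReal.ofReal_le_ofReal hyr.le
    _ = _ := by
        rw [lintegral_mul_const _ (by fun_prop), lintegral_mollifier, one_mul]

section Compactness

variable {ι : Type*} (𝒰 : Ultrafilter ι) {u : ι → Euc n → ℝ} {M : ℝ≥0}

lemma exists_tendsto_of_norm_le {f : ι → ℝ} {C : ℝ} (hf : ∀ k, ‖f k‖ ≤ C) :
    ∃ l, Tendsto f 𝒰 (𝓝 l) := by
  obtain ⟨l, -, hl⟩ := (isCompact_closedBall (0 : ℝ) C).ultrafilter_le_nhds (𝒰.map f)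
    (by
      rw [le_principal_iff]
      exact Filter.mem_map.2 (Eventually.of_forall fun k => by simpa using hf k))
  exact ⟨l, hl⟩

/-- `u` is a Cauchy family in `L¹(A)` along the ultrafilter `𝒰`. -/
def CauchyAlong (u : ι → Euc n → ℝ) (A : Set (Euc n)) : Prop :=
  ∀ η : ℝ≥0∞, 0 < η → ∃ S ∈ 𝒰, ∀ j ∈ S, ∀ k ∈ S, ∫⁻ x in A, ‖u j x - u k x‖ₑ ≤ η

/-- Arzelà-Ascoli for fixed `m`: an `L¹` bound on `u k` makes the mollified functions uniformly
bounded and uniformly Lipschitz. Pointwise limits along `𝒰` exist by boundedness, and a finite net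
transfers them to all of `K`. -/
lemma exists_mem_forall_mollify_sub_le (hu : ∀ k, Integrable (u k))
    (hM : ∀ k, ∫⁻ x, ‖u k x‖ₑ ≤ M) (m : ℕ) {K : Set (Euc n)} (hK : IsCompact K) {η : ℝ}
    (hη : 0 < η) : ∃ S ∈ 𝒰, ∀ j ∈ S, ∀ k ∈ S, ∀ x ∈ K,
      ‖mollify m (u j) x - mollify m (u k) x‖ ≤ η := by
  have hM' : ∀ k, ∫ x, ‖u k x‖ ≤ M := fun k => by
    rw [integral_norm_eq_lintegral_enorm (hu k).1]
    exact ENNReal.toReal_mono ENNReal.coe_ne_top (hM k)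
  obtain ⟨C, hC⟩ := (hasCompactSupport_mollifier (n := n) m).exists_bound_of_continuous
    (continuous_mollifier m)
  obtain ⟨L, hL⟩ := (show ContDiff ℝ 1 (mollifier n m) from
    (contDiff_mollifier m).of_le (by simp)).lipschitzWith_of_hasCompactSupport
    (hasCompactSupport_mollifier m) one_ne_zero
  have hC0 : 0 ≤ C := (norm_nonneg _).trans (hC 0)
  have hint : ∀ k x, Integrable fun y => mollifier n m (x - y) • u k y := fun k x =>
    integrable_mollifier_smul m (hu k).locallyIntegrable x
  have hlim : ∀ x, ∃ l, Tendsto (fun k => mollify m (u k) x) 𝒰 (𝓝 l) := fun x => by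
    refine exists_tendsto_of_norm_le 𝒰 (C := C * M) fun k => ?_
    rw [mollify_apply]
    calc ‖∫ y, mollifier n m (x - y) • u k y‖ ≤ ∫ y, C * ‖u k y‖ := by
          refine norm_integral_le_of_norm_le ((hu k).norm.const_mul _)
            (Eventually.of_forall fun y => ?_)
          rw [norm_smul]
          exact mul_le_mul_of_nonneg_right (hC _) (norm_nonneg _)
      _ ≤ C * M := by
          rw [integral_const_mul]
          exact mul_le_mul_of_nonneg_left (hM' k) hC0
  have hlip : ∀ k x y, ‖mollify m (u k) x - mollify m (u k) y‖ ≤ L * ‖x - y‖ * M :=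
      fun k x y => by
    rw [mollify_apply, mollify_apply, ← integral_sub (hint k x) (hint k y)]
    calc ‖∫ z, (mollifier n m (x - z) • u k z - mollifier n m (y - z) • u k z)‖
        ≤ ∫ z, L * ‖x - y‖ * ‖u k z‖ := by
          refine norm_integral_le_of_norm_le ((hu k).norm.const_mul _)
            (Eventually.of_forall fun z => ?_)
          rw [← sub_smul, norm_smul]
          refine mul_le_mul_of_nonneg_right ?_ (norm_nonneg _)
          have := hL.norm_sub_le (x - z) (y - z)
          rwa [sub_sub_sub_cancel_right] at this
      _ ≤ L * ‖x - y‖ * M := by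
          rw [integral_const_mul]
          exact mul_le_mul_of_nonneg_left (hM' k) (by positivity)
  -- At this mesh each passage to the nearest net point costs `η / 4`. Two such passages and two
  -- distances to the limits add up to `η`.
  obtain ⟨t, ht, htK⟩ := Metric.totallyBounded_iff.1 hK.totallyBounded
    (η / (4 * (L * M + 1))) (by positivity)
  choose l hl using hlim
  have hS : ∀ᶠ k in (𝒰 : Filter ι), ∀ y ∈ t, ‖mollify m (u k) y - l y‖ ≤ η / 4 := by
    refine (ht.eventually_all).2 fun y _ => ?_
    have := (hl y).eventually (closedBall_mem_nhds (l y) (by positivity : 0 < η / 4))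
    simpa [dist_eq_norm] using this
  refine ⟨_, hS, fun j hj k hk x hx => ?_⟩
  obtain ⟨y, hy, hxy⟩ := mem_iUnion₂.1 (htK hx)
  have h1 := hj y hy
  have h2 := hk y hy
  have hsmall : L * ‖x - y‖ * M ≤ η / 4 := by
    have h5 : ‖x - y‖ ≤ η / (4 * (L * M + 1)) := by
      rw [mem_ball, dist_eq_norm] at hxy
      exact hxy.le
    rw [le_div_iff₀ (by positivity)] at h5
    nlinarith [norm_nonneg (x - y)]
  have h3 := hlip j x y
  have h4 := hlip k x y
  have h6 : mollify m (u j) x - mollify m (u k) x =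
      (mollify m (u j) x - mollify m (u j) y) + (mollify m (u j) y - l y)
        - (mollify m (u k) y - l y) - (mollify m (u k) x - mollify m (u k) y) := by ring
  rw [h6]
  refine (norm_sub_le _ _).trans ?_
  have h7 := norm_sub_le ((mollify m (u j) x - mollify m (u j) y) + (mollify m (u j) y - l y))
    (mollify m (u k) y - l y)
  have h8 := norm_add_le (mollify m (u j) x - mollify m (u j) y) (mollify m (u j) y - l y)
  linarith

/-- Choose the mollification scale first, uniformly in `k`; at that fixed scale the family is
uniformly Cauchy on `K`. -/
lemma CauchyAlong.of_isCompact (hΩ : IsOpen Ω) {G : ι → Euc n → Euc n}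
    (hp : ∀ k, SobolevPair Ω (u k) (G k)) (hM : ∀ k, ∫⁻ x, ‖u k x‖ₑ ≤ M)
    (hMG : ∀ k, ∫⁻ x, ‖G k x‖ₑ ≤ M) {K : Set (Euc n)} (hK : IsCompact K) (hKΩ : K ⊆ Ω) :
    CauchyAlong 𝒰 u K := by
  intro η hη
  rcases eq_or_ne η ⊤ with rfl | hηt
  · exact ⟨univ, univ_mem, fun _ _ _ _ => le_top⟩
  lift η to ℝ≥0 using hηt
  have hη' : 0 < η := by exact_mod_cast hη
  obtain ⟨δ, hδ, hδK⟩ := hK.exists_cthickening_subset_open hΩ hKΩ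
  -- `δ` keeps the mollification of `K` inside `Ω`; the second bound makes each mollification error
  -- at most `η / 4`, the denominator `M + 1` covering `M = 0`.
  obtain ⟨m, hm⟩ : ∃ m, (bump n m).rOut ≤ min δ (η / (4 * (M + 1))) :=
    (tendsto_bump_rOut.eventually (Iic_mem_nhds
      (by positivity : 0 < min δ ((η : ℝ) / (4 * (M + 1)))))).exists
  obtain ⟨S, hS, hS'⟩ := exists_mem_forall_mollify_sub_le 𝒰 (fun k => (hp k).integrable) hM m hK
    (η := η / (2 * ((volume K).toReal + 1))) (by positivity)
  refine ⟨S, hS, fun j hj k hk => ?_⟩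
  have hmol : ∀ k, ∫⁻ x in K, ‖mollify m (u k) x - u k x‖ₑ ≤ ENNReal.ofReal (η / 4) := fun k => by
    refine ((hp k).lintegral_mollify_sub_le hΩ
      ((cthickening_mono (hm.trans (min_le_left _ _)) K).trans hδK)).trans ?_
    refine (mul_le_mul_right (hMG k) _).trans ?_
    rw [← ENNReal.ofReal_coe_nnreal, ← ENNReal.ofReal_mul (bump n m).rOut_pos.le]
    refine ENNReal.ofReal_le_ofReal ?_
    have := hm.trans (min_le_right _ _)
    rw [le_div_iff₀ (by positivity)] at this
    nlinarith [(bump n m).rOut_pos]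
  have hmid : ∫⁻ x in K, ‖mollify m (u j) x - mollify m (u k) x‖ₑ ≤ ENNReal.ofReal (η / 2) := by
    calc ∫⁻ x in K, ‖mollify m (u j) x - mollify m (u k) x‖ₑ
        ≤ ∫⁻ x in K, ENNReal.ofReal (η / (2 * ((volume K).toReal + 1))) := by
          refine setLIntegral_mono' hK.measurableSet fun x hx => ?_
          rw [← ofReal_norm]
          exact ENNReal.ofReal_le_ofReal (hS' j hj k hk x hx)
      _ ≤ ENNReal.ofReal (η / 2) := by
          rw [setLIntegral_const, ← ENNReal.ofReal_toReal hK.measure_lt_top.ne,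
            ← ENNReal.ofReal_mul (by positivity)]
          refine ENNReal.ofReal_le_ofReal ?_
          rw [ENNReal.toReal_ofReal ENNReal.toReal_nonneg, div_mul_eq_mul_div,
            div_le_div_iff₀ (by positivity) (by positivity)]
          nlinarith [ENNReal.toReal_nonneg (a := volume K), η.2]
  have hc : ∀ k, Continuous (mollify m (u k)) := fun k =>
    (contDiff_mollify m (hp k).integrable.locallyIntegrable).continuous
  have hmeas : ∀ k, Measurable (u k) := fun k => (hp k).measurable
  have := (hc j).measurable
  have := (hc k).measurable
  have := hmeas j
  have := hmeas k
  calc ∫⁻ x in K, ‖u j x - u k x‖ₑ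
      ≤ ∫⁻ x in K, (‖mollify m (u j) x - u j x‖ₑ + ‖mollify m (u k) x - u k x‖ₑ)
          + ‖mollify m (u j) x - mollify m (u k) x‖ₑ := by
        refine lintegral_mono fun x => ?_
        have h1 : u j x - u k x = (mollify m (u k) x - u k x - (mollify m (u j) x - u j x))
            + (mollify m (u j) x - mollify m (u k) x) := by ring
        simp only [h1]
        refine (enorm_add_le _ _).trans (add_le_add (enorm_sub_le.trans ?_) le_rfl)
        rw [add_comm]
    _ = (∫⁻ x in K, ‖mollify m (u j) x - u j x‖ₑ) + (∫⁻ x in K, ‖mollify m (u k) x - u k x‖ₑ)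
          + ∫⁻ x in K, ‖mollify m (u j) x - mollify m (u k) x‖ₑ := by
        rw [lintegral_add_left (by fun_prop), lintegral_add_left (by fun_prop)]
    _ ≤ ENNReal.ofReal (η / 4) + ENNReal.ofReal (η / 4) + ENNReal.ofReal (η / 2) :=
        add_le_add (add_le_add (hmol j) (hmol k)) hmid
    _ = η := by
        rw [← ENNReal.ofReal_add (by positivity) (by positivity),
          ← ENNReal.ofReal_add (by positivity) (by positivity), ← ENNReal.ofReal_coe_nnreal]
        congr 1
        ring

/-- Translation by `t` changes `u j - u k` by at most `2 M t` in `L¹`. Unlike for Poincaré this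
error must be small, so `t` depends on `η` and all small translations are needed. -/
lemma CauchyAlong.of_translate (hΩ : IsOpen Ω) {G : ι → Euc n → Euc n}
    (hp : ∀ k, SobolevPair Ω (u k) (G k)) (hMG : ∀ k, ∫⁻ x, ‖G k x‖ₑ ≤ M) (A : Set (Euc n))
    (e : Euc n) (t₀ : ℝ) (he : ‖e‖ = 1) (ht₀ : 0 < t₀)
    (h : ∀ t, 0 < t → t ≤ t₀ → (∀ y ∈ A, ∀ s ∈ Icc (0 : ℝ) 1, y + s • (t • e) ∈ Ω) ∧
      CauchyAlong 𝒰 u ((fun y => y + t • e) '' A)) : CauchyAlong 𝒰 u A := by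
  intro η hη
  rcases eq_or_ne η ⊤ with rfl | hηt
  · exact ⟨univ, univ_mem, fun _ _ _ _ => le_top⟩
  lift η to ℝ≥0 using hηt
  have hη' : 0 < η := by exact_mod_cast hη
  obtain ⟨htA, hcauchy⟩ := h (min t₀ (η / (4 * (M + 1)))) (by positivity) (min_le_left _ _)
  set t : ℝ := min t₀ (η / (4 * (M + 1)))
  have ht : 0 < t := by positivity
  obtain ⟨S, hS, hS'⟩ := hcauchy (ENNReal.ofReal (η / 2)) (by simpa using hη')
  refine ⟨S, hS, fun j hj k hk => ?_⟩
  have h1 := ((hp j).sub (hp k)).lintegral_le_translate hΩ (A := A) (t • e) 0 htA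
  simp only [Pi.sub_apply, sub_zero] at h1
  refine h1.trans ?_
  have h2 : ∫⁻ x, ‖G j x - G k x‖ₑ ≤ ENNReal.ofReal (2 * M) := by
    calc ∫⁻ x, ‖G j x - G k x‖ₑ ≤ ∫⁻ x, ‖G j x‖ₑ + ‖G k x‖ₑ := lintegral_mono fun x => enorm_sub_le
      _ = (∫⁻ x, ‖G j x‖ₑ) + ∫⁻ x, ‖G k x‖ₑ := lintegral_add_left' (hp j).integrable_grad.1.enorm _
      _ ≤ M + M := add_le_add (hMG j) (hMG k)
      _ = _ := by rw [two_mul, ENNReal.ofReal_add (NNReal.coe_nonneg M) (NNReal.coe_nonneg M),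
          ENNReal.ofReal_coe_nnreal]
  have h3 : ‖t • e‖ₑ * ∫⁻ x, ‖G j x - G k x‖ₑ ≤ ENNReal.ofReal (η / 2) := by
    refine (mul_le_mul_right h2 _).trans ?_
    rw [← ofReal_norm, norm_smul, he, mul_one, Real.norm_of_nonneg ht.le,
      ← ENNReal.ofReal_mul ht.le]
    refine ENNReal.ofReal_le_ofReal ?_
    have : t ≤ η / (4 * (M + 1)) := min_le_right _ _
    rw [le_div_iff₀ (by positivity)] at this
    nlinarith
  refine (add_le_add (hS' j hj k hk) h3).trans (le_of_eq ?_)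
  rw [← ENNReal.ofReal_add (by positivity) (by positivity), ← ENNReal.ofReal_coe_nnreal]
  congr 1
  ring

/-- Rellich's theorem in `W^{1,1}` of a bounded Lipschitz domain, along an ultrafilter. -/
theorem exists_tendsto_lintegral_sub (hΩ : IsOpen Ω) (hb : Bornology.IsBounded Ω)
    (hlip : HasLipschitzBoundary Ω) {G : ι → Euc n → Euc n}
    (hp : ∀ k, SobolevPair Ω (u k) (G k)) (hM : ∀ k, ∫⁻ x, ‖u k x‖ₑ ≤ M)
    (hMG : ∀ k, ∫⁻ x, ‖G k x‖ₑ ≤ M) :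
    ∃ w : Euc n → ℝ, IntegrableOn w Ω ∧
      Tendsto (fun k => ∫⁻ x in Ω, ‖u k x - w x‖ₑ) 𝒰 (𝓝 0) := by
  have hC : CauchyAlong 𝒰 u Ω := by
    refine lipschitz_domain_induction hΩ hb hlip (P := CauchyAlong 𝒰 u)
      (fun η _ => ⟨univ, univ_mem, by simp⟩)
      (fun A B hAB hB η hη => ?_) (fun A B hA hB η hη => ?_)
      (fun K hKΩ hK => CauchyAlong.of_isCompact 𝒰 hΩ hp hM hMG hK hKΩ)
      (CauchyAlong.of_translate 𝒰 hΩ hp hMG)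
    · obtain ⟨S, hS, h⟩ := hB η hη
      exact ⟨S, hS, fun j hj k hk => (lintegral_mono_set hAB).trans (h j hj k hk)⟩
    · obtain ⟨S, hS, h⟩ := hA (η / 2) (ENNReal.half_pos hη.ne')
      obtain ⟨S', hS', h'⟩ := hB (η / 2) (ENNReal.half_pos hη.ne')
      refine ⟨S ∩ S', inter_mem hS hS', fun j hj k hk => (lintegral_union_le _ _ _).trans ?_⟩
      rw [← ENNReal.add_halves η]
      exact add_le_add (h j hj.1 k hk.1) (h' j hj.2 k hk.2)
  have hmem : ∀ k, MemLp (u k) 1 (volume.restrict Ω) := fun k =>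
    memLp_one_iff_integrable.2 (hp k).integrable.restrict
  -- Completeness of `L¹(Ω)` turns the Cauchy property along `𝒰` into convergence.
  have hcau : Cauchy (Filter.map (fun k => (hmem k).toLp (u k)) (𝒰 : Filter ι)) := by
    refine EMetric.cauchy_iff.2 ⟨NeBot.ne inferInstance, fun ε hε => ?_⟩
    obtain ⟨S, hS, h⟩ := hC (ε / 2) (ENNReal.half_pos hε.ne')
    refine ⟨_, image_mem_map hS, forall_mem_image.2 fun j hj => forall_mem_image.2 fun k hk => ?_⟩
    rcases eq_or_ne ε ⊤ with rfl | hεt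
    · exact edist_lt_top _ _
    rw [Lp.edist_toLp_toLp, eLpNorm_one_eq_lintegral_enorm]
    exact (h j hj k hk).trans_lt (ENNReal.half_lt_self hε.ne' hεt)
  obtain ⟨w, hw⟩ := CompleteSpace.complete hcau
  refine ⟨w, memLp_one_iff_integrable.1 (Lp.memLp w), ?_⟩
  have h1 : Tendsto (fun k => (hmem k).toLp (u k)) 𝒰 (𝓝 w) := hw
  have h2 := (tendsto_iff_edist_tendsto_0).1 h1
  refine h2.congr fun k => ?_
  rw [Lp.edist_def, eLpNorm_one_eq_lintegral_enorm]
  refine lintegral_congr_ae ?_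
  filter_upwards [(hmem k).coeFn_toLp] with x hx
  simp [hx]

end Compactness

end Rellich

/-! ### Hahn-Banach duality and vague limits of vector fields -/

section Calibration

variable {n : ℕ} {μ : Measure (Euc n)}

section Duality

variable {X : Type*} [AddCommGroup X] [Module ℝ X]

/-- The `L¹` seminorm on `L²` of a finite measure. -/
def l1Seminorm (μ : Measure (Euc n)) [IsFiniteMeasure μ] : Seminorm ℝ (Lp (Euc n) 2 μ) :=
  Seminorm.of (fun q => ∫ x, ‖q x‖ ∂μ)
    (fun p q => by
      have hp := ((Lp.memLp p).integrable one_le_two).norm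
      have hq := ((Lp.memLp q).integrable one_le_two).norm
      rw [← integral_add hp hq]
      refine integral_mono_ae ((Lp.memLp (p + q)).integrable one_le_two).norm (hp.add hq) ?_
      filter_upwards [Lp.coeFn_add p q] with x hx
      rw [hx]
      exact norm_add_le _ _)
    (fun c q => by
      rw [← integral_const_mul]
      refine integral_congr_ae ?_
      filter_upwards [Lp.coeFn_smul c q] with x hx
      rw [hx, Pi.smul_apply, norm_smul])

lemma l1Seminorm_apply [IsFiniteMeasure μ] (q : Lp (Euc n) 2 μ) :
    l1Seminorm μ q = ∫ x, ‖q x‖ ∂μ := rfl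

/-- Makes a functional dominated by the `L¹` norm continuous on the Hilbert space `L²`, where Riesz
applies. -/
lemma exists_l1Seminorm_le (μ : Measure (Euc n)) [IsFiniteMeasure μ] :
    ∃ C : ℝ, ∀ q, l1Seminorm μ q ≤ C * ‖q‖ := by
  refine ⟨(μ univ ^ (1 / (1 : ℝ≥0∞).toReal - 1 / (2 : ℝ≥0∞).toReal)).toReal, fun q => ?_⟩
  have h := eLpNorm_le_eLpNorm_mul_rpow_measure_univ (one_le_two : (1 : ℝ≥0∞) ≤ 2)
    (Lp.memLp q).1
  have htop : μ univ ^ (1 / (1 : ℝ≥0∞).toReal - 1 / (2 : ℝ≥0∞).toReal) ≠ ⊤ :=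
    ENNReal.rpow_ne_top_of_nonneg (by norm_num) (measure_ne_top μ univ)
  rw [eLpNorm_one_eq_lintegral_enorm] at h
  have h' := ENNReal.toReal_mono (ENNReal.mul_ne_top (Lp.eLpNorm_ne_top q) htop) h
  rw [ENNReal.toReal_mul, mul_comm, ← Lp.norm_def] at h'
  rwa [l1Seminorm_apply, integral_norm_eq_lintegral_enorm (Lp.memLp q).1]

/-- Test with `N / |N|` on `{|N| > 1}`: the integral of `|N| - 1` over that set is then nonpositive.
-/
lemma ae_norm_le_one_of_integral_inner_le [IsFiniteMeasure μ] {N : Euc n → Euc n}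
    (hN : MemLp N 2 μ) (hm : StronglyMeasurable N)
    (h : ∀ q : Euc n → Euc n, MemLp q 2 μ → ∫ x, inner ℝ (N x) (q x) ∂μ ≤ ∫ x, ‖q x‖ ∂μ) :
    ∀ᵐ x ∂μ, ‖N x‖ ≤ 1 := by
  let S : Set (Euc n) := {x | 1 < ‖N x‖}
  have hS : MeasurableSet S := measurableSet_lt measurable_const hm.norm.measurable
  let q : Euc n → Euc n := S.indicator fun x => ‖N x‖⁻¹ • N x
  have hq : MemLp q 2 μ := by
    refine MemLp.of_bound ?_ 1 (Eventually.of_forall fun x => ?_)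
    · exact ((hm.norm.measurable.inv.stronglyMeasurable.smul hm).indicator hS).aestronglyMeasurable
    · by_cases hx : x ∈ S
      · simp only [q, indicator_of_mem hx, norm_smul, norm_inv, norm_norm]
        exact inv_mul_le_one
      · simp [q, indicator_of_notMem hx]
  have h1 : ∀ x, inner ℝ (N x) (q x) = S.indicator (fun x => ‖N x‖) x := fun x => by
    by_cases hx : x ∈ S
    · have : ‖N x‖ ≠ 0 := (zero_lt_one.trans hx).ne'
      simp only [q, indicator_of_mem hx, real_inner_smul_right, real_inner_self_eq_norm_sq]
      field_simp
    · simp [q, indicator_of_notMem hx]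
  have h2 : ∀ x, ‖q x‖ = S.indicator (fun _ => (1 : ℝ)) x := fun x => by
    by_cases hx : x ∈ S
    · have : ‖N x‖ ≠ 0 := (zero_lt_one.trans hx).ne'
      simp [q, indicator_of_mem hx, norm_smul, this]
    · simp [q, indicator_of_notMem hx]
  have h3 := h q hq
  simp only [h1, h2] at h3
  rw [integral_indicator hS, integral_indicator hS, ← sub_nonpos, ← integral_sub
    (hN.integrable one_le_two).norm.restrict (integrable_const _)] at h3
  have h4 : 0 ≤ᵐ[μ.restrict S] fun x => ‖N x‖ - 1 := by
    filter_upwards [ae_restrict_mem hS] with x hx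
    exact sub_nonneg.2 (le_of_lt hx)
  have h5 := (integral_eq_zero_iff_of_nonneg_ae h4
    ((hN.integrable one_le_two).norm.restrict.sub (integrable_const _))).1
    (le_antisymm h3 (integral_nonneg_of_ae h4))
  rw [Filter.EventuallyEq, ae_restrict_iff' hS] at h5
  filter_upwards [h5] with x hx
  by_contra hx'
  have hxS : x ∈ S := not_le.1 hx'
  have h6 := hx hxS
  simp only [Pi.zero_apply] at h6
  exact hx' (by linarith)

/-- A linear functional dominated by the `L¹` norm is represented by a field bounded by `1`. -/
theorem exists_field_of_le_integral_norm [IsFiniteMeasure μ] (A : X →ₗ[ℝ] (Euc n → Euc n))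
    (hA : ∀ x, MemLp (A x) 2 μ) (l : X →ₗ[ℝ] ℝ) (hl : ∀ x, l x ≤ ∫ y, ‖A x y‖ ∂μ) :
    ∃ N : Euc n → Euc n, StronglyMeasurable N ∧ (∀ᵐ y ∂μ, ‖N y‖ ≤ 1) ∧
      ∀ x, l x = ∫ y, inner ℝ (N y) (A x y) ∂μ := by
  let A' : X →ₗ[ℝ] Lp (Euc n) 2 μ :=
    { toFun := fun x => (hA x).toLp (A x)
      map_add' := fun x y => by
        rw [← MemLp.toLp_add (hA x) (hA y)]
        congr 1
        exact map_add A x y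
      map_smul' := fun c x => by
        rw [RingHom.id_apply, ← MemLp.toLp_const_smul c (hA x)]
        congr 1
        exact map_smul A c x }
  have hA' : ∀ x, A' x =ᵐ[μ] A x := fun x => (hA x).coeFn_toLp
  have hl' : ∀ x, l x ≤ l1Seminorm μ (A' x) := fun x => by
    refine (hl x).trans (le_of_eq (integral_congr_ae ?_))
    exact (EventuallyEq.fun_comp (hA' x) norm).symm
  -- Domination at `x` and `-x` makes `l` vanish where `A' x = 0`, so `l` descends to the range of
  -- `A'`.
  have hker : LinearMap.ker A' ≤ LinearMap.ker l := fun x hx => by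
    rw [LinearMap.mem_ker] at hx ⊢
    have h1 := hl' x
    have h2 := hl' (-x)
    rw [map_neg, map_neg, hx, neg_zero, map_zero] at h2
    rw [hx, map_zero] at h1
    linarith
  let f : Module.Dual ℝ (LinearMap.range A') :=
    ((LinearMap.ker A').liftQ l hker).comp (A'.quotKerEquivRange.symm : _ →ₗ[ℝ] _)
  have hf : ∀ x, f ⟨A' x, LinearMap.mem_range_self A' x⟩ = l x := fun x => by
    have : A'.quotKerEquivRange.symm ⟨A' x, LinearMap.mem_range_self A' x⟩ =
        (LinearMap.ker A').mkQ x := by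
      rw [LinearEquiv.symm_apply_eq]
      rfl
    simp [f, this]
  -- The extension lives on `L²` but is dominated by the `L¹` seminorm: the first gives a Riesz
  -- representative, the second bounds it by `1`.
  obtain ⟨b, hb, hbp⟩ := Module.Dual.exists_extension_of_le_seminorm_real _ f
    (p := l1Seminorm μ) (by rintro ⟨_, x, rfl⟩; rw [hf]; exact hl' x)
  obtain ⟨C, hC⟩ := exists_l1Seminorm_le μ
  let b' : StrongDual ℝ (Lp (Euc n) 2 μ) :=
    b.mkContinuous C fun q => (hbp q).trans (hC q)
  let N : Lp (Euc n) 2 μ := (InnerProductSpace.toDual ℝ _).symm b'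
  have hN : ∀ q, b q = ∫ y, inner ℝ (N y) (q y) ∂μ := fun q => by
    have : inner ℝ N q = b' q := InnerProductSpace.toDual_symm_apply
    rw [L2.inner_def] at this
    exact this.symm
  refine ⟨N, Lp.stronglyMeasurable N, ?_, fun x => ?_⟩
  · refine ae_norm_le_one_of_integral_inner_le (Lp.memLp N) (Lp.stronglyMeasurable N)
      fun q hq => ?_
    have h1 := (le_abs_self _).trans (hbp (hq.toLp q))
    rw [hN, l1Seminorm_apply] at h1
    have h2 : ∫ y, inner ℝ (N y) (hq.toLp q y) ∂μ = ∫ y, inner ℝ (N y) (q y) ∂μ := by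
      refine integral_congr_ae ?_
      filter_upwards [hq.coeFn_toLp] with y hy
      rw [hy]
    have h3 : ∫ y, ‖hq.toLp q y‖ ∂μ = ∫ y, ‖q y‖ ∂μ := by
      refine integral_congr_ae ?_
      filter_upwards [hq.coeFn_toLp] with y hy
      rw [hy]
    rwa [h2, h3] at h1
  · rw [← hf x, ← hb ⟨A' x, LinearMap.mem_range_self A' x⟩, hN]
    refine integral_congr_ae ?_
    filter_upwards [hA' x] with y hy
    rw [hy]

lemma integral_norm_smul_add_smul {c : ℝ} (hc : 0 ≤ c) (f : Euc n → Euc n) :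
    ∫ y, ‖c • f y‖ ∂μ = c * ∫ y, ‖f y‖ ∂μ := by
  simp_rw [norm_smul, Real.norm_of_nonneg hc]
  exact integral_const_mul _ _

/-- Duality for the least gradient type functional `x ↦ ∫ ‖A x + F‖ - l x`: there is a
calibrating field `N`, which is saturated in the limit by a minimizing sequence. -/
theorem exists_calibration [IsFiniteMeasure μ] (A : X →ₗ[ℝ] (Euc n → Euc n))
    (hA : ∀ x, MemLp (A x) 2 μ) (l : X →ₗ[ℝ] ℝ) (hl : ∀ x, l x ≤ ∫ y, ‖A x y‖ ∂μ)
    {F : Euc n → Euc n} (hF : MemLp F 2 μ) :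
    ∃ N : Euc n → Euc n, StronglyMeasurable N ∧ (∀ᵐ y ∂μ, ‖N y‖ ≤ 1) ∧
      (∀ x, l x = ∫ y, inner ℝ (N y) (A x y) ∂μ) ∧
      ∃ x : ℕ → X, (∃ M, ∀ k, ∫ y, ‖A (x k) y + F y‖ ∂μ - l (x k) ≤ M) ∧
        Tendsto (fun k => ∫ y, (‖A (x k) y + F y‖ - inner ℝ (N y) (A (x k) y + F y)) ∂μ)
          atTop (𝓝 0) := by
  have hAi : ∀ x, Integrable (A x) μ := fun x => (hA x).integrable one_le_two
  have hFi : Integrable F μ := hF.integrable one_le_two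
  let J : X → ℝ := fun x => ∫ y, ‖A x y + F y‖ ∂μ - l x
  -- Apply `hl` to `z + y` and split off `±F`. With `y = 0` this bounds `J` below; for general `y`
  -- it is the domination needed for negative multiples of `F`.
  have key : ∀ z y, l y - ∫ w, ‖A y w - F w‖ ∂μ ≤ J z := fun z y => by
    have h1 : ∫ w, ‖A (z + y) w‖ ∂μ ≤ ∫ w, (‖A z w + F w‖ + ‖A y w - F w‖) ∂μ := by
      refine integral_mono (hAi _).norm (((hAi z).add hFi).norm.add ((hAi y).sub hFi).norm)
        fun w => ?_
      simp only [map_add, Pi.add_apply]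
      calc ‖A z w + A y w‖ = ‖(A z w + F w) + (A y w - F w)‖ := by congr 1; abel
        _ ≤ _ := norm_add_le _ _
    rw [integral_add (f := fun w => ‖A z w + F w‖) (g := fun w => ‖A y w - F w‖)
      ((hAi z).add hFi).norm ((hAi y).sub hFi).norm] at h1
    have h2 := hl (z + y)
    rw [map_add] at h2
    simp only [J]
    linarith
  have hbdd : BddBelow (range J) := ⟨_, forall_mem_range.2 fun z => key z 0⟩
  let m : ℝ := ⨅ x, J x
  have hm : ∀ x, m ≤ J x := fun x => ciInf_le hbdd x
  have hm' : ∀ y, l y - ∫ w, ‖A y w - F w‖ ∂μ ≤ m := fun y => le_ciInf fun z => key z y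
  -- Adjoin `F` to the range with prescribed value `m`. By homogeneity, domination says `m ≤ J` when
  -- `t > 0` and is `hm'` when `t < 0`. If `F` already lies in the range, consistency follows from
  -- the domination.
  let A₁ : X × ℝ →ₗ[ℝ] (Euc n → Euc n) :=
    A.comp (LinearMap.fst ℝ X ℝ) + (LinearMap.snd ℝ X ℝ).smulRight F
  let l₁ : X × ℝ →ₗ[ℝ] ℝ :=
    l.comp (LinearMap.fst ℝ X ℝ) + (LinearMap.snd ℝ X ℝ).smulRight m
  have hA₁ : ∀ p, A₁ p = A p.1 + p.2 • F := fun p => rfl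
  have hl₁ : ∀ p, l₁ p = l p.1 + p.2 * m := fun p => rfl
  have hdom : ∀ p, l₁ p ≤ ∫ y, ‖A₁ p y‖ ∂μ := by
    rintro ⟨x, t⟩
    rw [hl₁, hA₁]
    rcases lt_trichotomy t 0 with ht | rfl | ht
    · have h1 := hm' ((-t)⁻¹ • x)
      have h2 : ∫ w, ‖A x w + t • F w‖ ∂μ = -t * ∫ w, ‖A ((-t)⁻¹ • x) w - F w‖ ∂μ := by
        rw [← integral_norm_smul_add_smul (by linarith)]
        refine integral_congr_ae (Eventually.of_forall fun w => ?_)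
        simp only [map_smul, Pi.smul_apply, smul_sub, smul_smul]
        rw [mul_inv_cancel₀ (by linarith), one_smul, neg_smul, sub_neg_eq_add]
      simp only [Pi.add_apply, Pi.smul_apply]
      rw [h2]
      rw [map_smul, smul_eq_mul] at h1
      have h3 := mul_le_mul_of_nonneg_left h1 (by linarith : 0 ≤ -t)
      rw [mul_sub, ← mul_assoc, mul_inv_cancel₀ (by linarith), one_mul] at h3
      linarith
    · simpa using hl x
    · have h1 := hm (t⁻¹ • x)
      have h2 : ∫ w, ‖A x w + t • F w‖ ∂μ = t * ∫ w, ‖A (t⁻¹ • x) w + F w‖ ∂μ := by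
        rw [← integral_norm_smul_add_smul ht.le]
        refine integral_congr_ae (Eventually.of_forall fun w => ?_)
        simp only [map_smul, Pi.smul_apply, smul_add, smul_smul]
        rw [mul_inv_cancel₀ ht.ne', one_smul]
      simp only [Pi.add_apply, Pi.smul_apply]
      rw [h2]
      simp only [J] at h1
      rw [map_smul l, smul_eq_mul] at h1
      have h3 := mul_le_mul_of_nonneg_left h1 ht.le
      rw [mul_sub, ← mul_assoc, mul_inv_cancel₀ ht.ne', one_mul] at h3
      linarith
  obtain ⟨N, hNm, hN1, hN⟩ := exists_field_of_le_integral_norm A₁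
    (fun p => (hA p.1).add (hF.const_smul p.2)) l₁ hdom
  have hNx : ∀ x, l x = ∫ y, inner ℝ (N y) (A x y) ∂μ := fun x => by
    have := hN (x, 0)
    rw [hl₁, hA₁] at this
    simpa using this
  have hNF : m = ∫ y, inner ℝ (N y) (F y) ∂μ := by
    have := hN (0, 1)
    rw [hl₁, hA₁] at this
    simpa using this
  have hNi : ∀ {q : Euc n → Euc n}, Integrable q μ →
      Integrable (fun y => inner ℝ (N y) (q y)) μ := fun {q} hq => by
    refine hq.norm.mono' (hNm.aestronglyMeasurable.inner hq.1) ?_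
    filter_upwards [hN1] with y hy
    exact (norm_inner_le_norm _ _).trans (mul_le_of_le_one_left (norm_nonneg _) hy)
  obtain ⟨v, hv, hvm⟩ : ∃ v : ℕ → ℝ, Tendsto v atTop (𝓝 m) ∧ ∀ k, v k ∈ range J := by
    obtain ⟨v, -, hv, hv'⟩ := exists_seq_tendsto_sInf (range_nonempty J) hbdd
    exact ⟨v, hv, hv'⟩
  choose x hx using hvm
  refine ⟨N, hNm, hN1, hNx, x, ?_, ?_⟩
  · obtain ⟨M, hM⟩ := hv.bddAbove_range
    exact ⟨M, fun k => (hx k).le.trans (hM (mem_range_self k))⟩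
  -- Since `l = ∫ N · A` and `m = ∫ N · F`, the calibration defect is exactly `J (x k) - m`.
  · have h1 : ∀ k, ∫ y, (‖A (x k) y + F y‖ - inner ℝ (N y) (A (x k) y + F y)) ∂μ = v k - m :=
        fun k => by
      have hs : Integrable (fun y => A (x k) y + F y) μ := (hAi _).add hFi
      rw [integral_sub hs.norm (hNi hs), ← hx k, hNF]
      simp only [inner_add_right]
      rw [integral_add (hNi (hAi _)) (hNi hFi), ← hNx]
      simp only [J]
      ring
    simp only [h1]
    simpa using hv.sub_const m

end Duality

/-- Vague compactness: along an ultrafilter, an `L¹`-bounded family of fields on a bounded set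
converges to a vector measure `τ λ` and their norms converge to `λ`. -/
theorem exists_limit_measure {ι : Type*} (𝒰 : Ultrafilter ι) [IsFiniteMeasure μ] {K : Set (Euc n)}
    (hK : IsCompact K) (hμK : μ Kᶜ = 0) {T : ι → Euc n → Euc n} (hT : ∀ k, Integrable (T k) μ)
    {M : ℝ≥0} (hM : ∀ k, ∫⁻ x, ‖T k x‖ₑ ∂μ ≤ M) :
    ∃ (ν : Measure (Euc n)) (τ : Euc n → Euc n), IsFiniteMeasure ν ∧ StronglyMeasurable τ ∧
      (∀ᵐ x ∂ν, ‖τ x‖ ≤ 1) ∧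
      (∀ ψ : Euc n →ᵇ ℝ, Tendsto (fun k => ∫ x, ψ x * ‖T k x‖ ∂μ) 𝒰 (𝓝 (∫ x, ψ x ∂ν))) ∧
      ∀ ψ : Euc n →ᵇ Euc n, Tendsto (fun k => ∫ x, inner ℝ (ψ x) (T k x) ∂μ) 𝒰
        (𝓝 (∫ x, inner ℝ (τ x) (ψ x) ∂ν)) := by
  have hfin : ∀ k, IsFiniteMeasure (μ.withDensity fun x => ‖T k x‖ₑ) := fun k =>
    ⟨by simpa using (hM k).trans_lt ENNReal.coe_lt_top⟩
  let μ' : ι → FiniteMeasure (Euc n) := fun k => ⟨μ.withDensity fun x => ‖T k x‖ₑ, hfin k⟩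
  have hint : ∀ k (ψ : Euc n → ℝ), ∫ x, ψ x ∂(μ' k : Measure (Euc n)) = ∫ x, ψ x * ‖T k x‖ ∂μ :=
      fun k ψ => by
    change ∫ x, ψ x ∂(μ.withDensity fun x => ‖T k x‖ₑ) = _
    rw [integral_withDensity_eq_integral_toReal_smul₀ (hT k).1.enorm
      (Eventually.of_forall fun x => by simp)]
    simp [mul_comm]
  -- Finite measures of mass at most `M` carried by the compact set `K` form a compact set, so the
  -- ultrafilter converges.
  obtain ⟨ν, -, hν⟩ := (isCompact_setOfPred_finiteMeasure_le_of_isCompact M hK).ultrafilter_le_nhds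
    (𝒰.map μ') (by
      rw [le_principal_iff]
      refine Filter.mem_map.2 (Eventually.of_forall fun k => ⟨?_, ?_⟩)
      · rw [← ENNReal.coe_le_coe, FiniteMeasure.ennreal_mass]
        simpa [μ'] using hM k
      · rw [← ENNReal.coe_eq_zero, FiniteMeasure.ennreal_coeFn_eq_coeFn_toMeasure]
        exact withDensity_absolutelyContinuous _ _ hμK)
  have hν1 : ∀ ψ : Euc n →ᵇ ℝ,
      Tendsto (fun k => ∫ x, ψ x * ‖T k x‖ ∂μ) 𝒰 (𝓝 (∫ x, ψ x ∂(ν : Measure (Euc n)))) := fun ψ => by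
    have h1 : Tendsto μ' 𝒰 (𝓝 ν) := hν
    have h2 := FiniteMeasure.tendsto_iff_forall_integral_tendsto.1 h1 ψ
    simpa only [hint] using h2
  have hb : ∀ k, ∫ x, ‖T k x‖ ∂μ ≤ M := fun k => by
    rw [integral_norm_eq_lintegral_enorm (hT k).1]
    exact ENNReal.toReal_mono ENNReal.coe_ne_top (hM k)
  have hinner : ∀ k (ψ : Euc n →ᵇ Euc n), Integrable (fun x => inner ℝ (ψ x) (T k x)) μ :=
      fun k ψ => by
    refine ((hT k).norm.const_mul ‖ψ‖).mono'
      (ψ.continuous.aestronglyMeasurable.inner (hT k).1) (Eventually.of_forall fun x => ?_)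
    exact (norm_inner_le_norm _ _).trans (mul_le_mul_of_nonneg_right (ψ.norm_coe_le_norm x)
      (norm_nonneg _))
  have hex : ∀ ψ : Euc n →ᵇ Euc n, ∃ l, Tendsto (fun k => ∫ x, inner ℝ (ψ x) (T k x) ∂μ) 𝒰 (𝓝 l) :=
      fun ψ => by
    refine exists_tendsto_of_norm_le 𝒰 (C := ‖ψ‖ * M) fun k => ?_
    calc ‖∫ x, inner ℝ (ψ x) (T k x) ∂μ‖ ≤ ∫ x, ‖ψ‖ * ‖T k x‖ ∂μ := by
          refine norm_integral_le_of_norm_le ((hT k).norm.const_mul _)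
            (Eventually.of_forall fun x => ?_)
          exact (norm_inner_le_norm _ _).trans (mul_le_mul_of_nonneg_right (ψ.norm_coe_le_norm x)
            (norm_nonneg _))
      _ ≤ ‖ψ‖ * M := by
          rw [integral_const_mul]
          exact mul_le_mul_of_nonneg_left (hb k) (norm_nonneg _)
  choose l hl using hex
  let L : (Euc n →ᵇ Euc n) →ₗ[ℝ] ℝ :=
    { toFun := l
      map_add' := fun ψ ψ' => by
        refine tendsto_nhds_unique (hl (ψ + ψ')) (((hl ψ).add (hl ψ')).congr fun k => ?_)
        rw [← integral_add (hinner k ψ) (hinner k ψ')]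
        simp [inner_add_left]
      map_smul' := fun c ψ => by
        refine tendsto_nhds_unique (hl (c • ψ)) (((hl ψ).const_mul c).congr fun k => ?_)
        rw [← integral_const_mul]
        simp [real_inner_smul_left] }
  let A : (Euc n →ᵇ Euc n) →ₗ[ℝ] (Euc n → Euc n) :=
    { toFun := fun ψ => ψ
      map_add' := fun _ _ => rfl
      map_smul' := fun _ _ => rfl }
  -- In the limit, `ψ · T k ≤ |ψ| |T k|` becomes `L ψ ≤ ∫ |ψ| dν`, so the representation used for
  -- `N` also gives `τ`, now with respect to `ν`.
  obtain ⟨τ, hτm, hτ1, hτ⟩ := exists_field_of_le_integral_norm (μ := (ν : Measure (Euc n))) A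
    (fun ψ => MemLp.of_bound ψ.continuous.aestronglyMeasurable ‖ψ‖
      (Eventually.of_forall ψ.norm_coe_le_norm)) L (fun ψ => by
        refine le_of_tendsto_of_tendsto (hl ψ) (hν1 (ψ.normComp)) ?_
        refine Eventually.of_forall fun k => ?_
        refine integral_mono (hinner k ψ) ?_ fun x => real_inner_le_norm _ _
        exact (hT k).norm.bdd_mul ψ.normComp.continuous.aestronglyMeasurable
          (Eventually.of_forall ψ.normComp.norm_coe_le_norm))
  refine ⟨ν, τ, inferInstance, hτm, hτ1, hν1, fun ψ => ?_⟩
  have := hl ψ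
  rwa [show l ψ = _ from hτ ψ] at this

end Calibration

/-! ### Mollified fields `φ N` as test fields -/

section MollifiedFields

variable {n : ℕ} {Ω : Set (Euc n)}

lemma norm_mollify_le_mollify {V : Type*} [NormedAddCommGroup V] [NormedSpace ℝ V] (m : ℕ)
    {f : Euc n → V} {g : Euc n → ℝ} (hg : LocallyIntegrable g) (h : ∀ᵐ y, ‖f y‖ ≤ g y)
    (x : Euc n) : ‖mollify m f x‖ ≤ mollify m g x := by
  rw [mollify_apply, mollify_apply]
  refine norm_integral_le_of_norm_le (integrable_mollifier_smul m hg x) ?_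
  filter_upwards [h] with y hy
  rw [norm_smul, Real.norm_of_nonneg (mollifier_nonneg m _), smul_eq_mul]
  exact mul_le_mul_of_nonneg_left hy (mollifier_nonneg m _)

lemma mollify_const (m : ℕ) (c : ℝ) (x : Euc n) : mollify m (fun _ => c) x = c := by
  rw [mollify_apply']
  simp only [smul_eq_mul]
  rw [integral_mul_const, integral_mollifier, one_mul]

lemma norm_mollify_le {V : Type*} [NormedAddCommGroup V] [NormedSpace ℝ V] (m : ℕ)
    {f : Euc n → V} {C : ℝ} (h : ∀ᵐ y, ‖f y‖ ≤ C) (x : Euc n) : ‖mollify m f x‖ ≤ C :=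
  (norm_mollify_le_mollify m (locallyIntegrable_const C) h x).trans (mollify_const m C x).le

lemma mollify_coord (m : ℕ) {W : Euc n → Euc n} (hW : LocallyIntegrable W) (x : Euc n)
    (i : Fin n) : mollify m W x i = mollify m (fun y => W y i) x := by
  rw [mollify_apply, mollify_apply]
  have := (EuclideanSpace.proj (𝕜 := ℝ) i).integral_comp_comm (integrable_mollifier_smul m hW x)
  simpa using this.symm

lemma tsupport_mollify_subset {V : Type*} [NormedAddCommGroup V] [NormedSpace ℝ V] (m : ℕ)
    {f : Euc n → V} {K : Set (Euc n)} (hf : Function.support f ⊆ K) :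
    tsupport (mollify m f) ⊆ cthickening (bump n m).rOut K := by
  refine closure_minimal (fun x hx => ?_) isClosed_cthickening
  obtain ⟨a, ha, b, hb, rfl⟩ := support_convolution_subset (lsmul ℝ ℝ) hx
  rw [support_mollifier, mem_ball_zero_iff] at ha
  refine closedBall_subset_cthickening (hf hb) _ ?_
  rw [mem_closedBall, dist_eq_norm]
  simpa using ha.le

lemma IsTestFunction.mul_mollifier {φ : Euc n → ℝ} (hφ : IsTestFunction Ω φ) (m : ℕ) (x : Euc n) :
    IsTestFunction Ω fun y => φ y * mollifier n m (x - y) where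
  smooth := hφ.smooth.mul ((contDiff_mollifier m).comp (contDiff_const.sub contDiff_id))
  compactSupport := hφ.compactSupport.mul_right
  support_subset := (tsupport_mul_subset_left).trans hφ.support_subset

lemma IsTestFunction.integrable_of_bound {φ : Euc n → ℝ} (hφ : IsTestFunction Ω φ)
    (ν : Measure (Euc n)) [IsFiniteMeasure ν] : Integrable φ ν := by
  obtain ⟨C, -, hC⟩ := hφ.exists_bound
  exact Integrable.of_bound hφ.smooth.continuous.aestronglyMeasurable C (Eventually.of_forall hC)

lemma gradient_apply (φ : Euc n → ℝ) (x : Euc n) (i : Fin n) :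
    ∇ φ x i = fderiv ℝ φ x (EuclideanSpace.single i 1) := by
  rw [← inner_gradient, EuclideanSpace.inner_single_right]
  simp

lemma gradient_mul {φ ψ : Euc n → ℝ} {x : Euc n} (hφ : DifferentiableAt ℝ φ x)
    (hψ : DifferentiableAt ℝ ψ x) :
    ∇ (fun y => φ y * ψ y) x = φ x • ∇ ψ x + ψ x • ∇ φ x := by
  simp only [gradient]
  rw [fderiv_fun_mul hφ hψ, map_add, map_smulₛₗ, map_smulₛₗ]
  simp

/-- The divergence commutes with mollification and `div (φ N) = φ d + N · ∇φ`. The cutoff `φ` makes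
`φ ρ(x - ·)` a test function in `Ω` for every `x`, so no distance to the boundary is required. -/
lemma sum_fderiv_mollify {φ : Euc n → ℝ} (hφ : IsTestFunction Ω φ) (hm : MeasurableSet Ω)
    {N : Euc n → Euc n} {d : Euc n → ℝ}
    (hN : IntegrableOn N Ω) (hd : IntegrableOn d Ω) (hdiv : IsWeakDivergence Ω N d)
    (m : ℕ) (x : Euc n) :
    ∑ i, fderiv ℝ (mollify m fun y => Ω.indicator (fun z => φ z • N z) y i) x
        (EuclideanSpace.single i 1) =
      mollify m (Ω.indicator fun z => φ z * d z + inner ℝ (N z) (∇ φ z)) x := by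
  set W : Euc n → Euc n := Ω.indicator fun z => φ z • N z with hW
  have hWi : Integrable W := (integrable_indicator_iff hm).2 (hφ.integrable_smul hN)
  have hWic : ∀ i, Integrable fun y => W y i := fun i =>
    (EuclideanSpace.proj (𝕜 := ℝ) i).integrable_comp hWi
  have hρ : ContDiff ℝ ∞ (mollifier n m) := contDiff_mollifier m
  obtain ⟨C, hC⟩ := ((hasCompactSupport_mollifier (n := n) m).fderiv ℝ).exists_bound_of_continuous
    (hρ.continuous_fderiv (by simp))
  have hcont : Continuous fun y => fderiv ℝ (mollifier n m) (x - y) :=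
    (hρ.continuous_fderiv (by simp)).comp (by fun_prop)
  have hint : ∀ i, Integrable fun y => W y i *
      fderiv ℝ (mollifier n m) (x - y) (EuclideanSpace.single i 1) := fun i => by
    refine (hWic i).mul_bdd (c := C) (hcont.clm_apply continuous_const).aestronglyMeasurable
      (Eventually.of_forall fun y => ?_)
    refine (le_opNorm _ _).trans ?_
    simpa using hC (x - y)
  have h1 : ∑ i, fderiv ℝ (mollify m fun y => W y i) x (EuclideanSpace.single i 1) =
      ∫ y in Ω, φ y * fderiv ℝ (mollifier n m) (x - y) (N y) := by
    calc ∑ i, fderiv ℝ (mollify m fun y => W y i) x (EuclideanSpace.single i 1)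
        = ∑ i, ∫ y, W y i * fderiv ℝ (mollifier n m) (x - y) (EuclideanSpace.single i 1) :=
          Finset.sum_congr rfl fun i _ => (fderiv_mollify m (hWic i).locallyIntegrable x _).2
      _ = ∫ y, ∑ i, W y i * fderiv ℝ (mollifier n m) (x - y) (EuclideanSpace.single i 1) :=
          (integral_finsetSum _ fun i _ => hint i).symm
      _ = ∫ y, fderiv ℝ (mollifier n m) (x - y) (W y) := by
          refine integral_congr_ae (Eventually.of_forall fun y => ?_)
          have h2 : W y = ∑ i, W y i • EuclideanSpace.single i (1 : ℝ) := by
            ext j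
            simp [Finset.sum_apply, Pi.single_apply]
          have h3 := congrArg (fderiv ℝ (mollifier n m) (x - y)) h2
          rw [map_sum] at h3
          simpa using h3.symm
      _ = ∫ y, Ω.indicator (fun y => φ y * fderiv ℝ (mollifier n m) (x - y) (N y)) y := by
          refine integral_congr_ae (Eventually.of_forall fun y => ?_)
          by_cases hy : y ∈ Ω
          · simp [hW, hy]
          · simp [hW, hy]
      _ = _ := integral_indicator hm
  have hζ := hφ.mul_mollifier m x
  have h3 := hdiv _ hζ
  have h4 : ∀ y, inner ℝ (N y) (∇ (fun y => φ y * mollifier n m (x - y)) y) =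
      mollifier n m (x - y) * inner ℝ (N y) (∇ φ y)
        - φ y * fderiv ℝ (mollifier n m) (x - y) (N y) := fun y => by
    have hρd : DifferentiableAt ℝ (fun y => mollifier n m (x - y)) y :=
      (hρ.comp (contDiff_const.sub contDiff_id)).differentiable (by simp) y
    rw [gradient_mul (hφ.smooth.differentiable (by simp) y) hρd, inner_add_right,
      real_inner_smul_right, real_inner_smul_right, real_inner_comm, inner_gradient_mollifier]
    ring
  have hNφ : IntegrableOn (fun y => inner ℝ (N y) (∇ φ y)) Ω := by
    obtain ⟨C', -, hC'⟩ := hφ.exists_gradient_bound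
    refine (hN.norm.mul_const C').mono'
      (hN.1.inner hφ.continuous_gradient.aestronglyMeasurable) (Eventually.of_forall fun y => ?_)
    exact (norm_inner_le_norm _ _).trans (mul_le_mul_of_nonneg_left (hC' y) (norm_nonneg _))
  have hρint : ∀ {f : Euc n → ℝ}, IntegrableOn f Ω →
      IntegrableOn (fun y => mollifier n m (x - y) * f y) Ω := fun {f} hf => by
    obtain ⟨C', hC'⟩ := (hasCompactSupport_mollifier (n := n) m).exists_bound_of_continuous
      (continuous_mollifier m)
    exact hf.bdd_mul (c := C') ((continuous_mollifier m).comp (by fun_prop)).aestronglyMeasurable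
      (Eventually.of_forall fun y => hC' _)
  have hφN : IntegrableOn (fun y => φ y * fderiv ℝ (mollifier n m) (x - y) (N y)) Ω := by
    obtain ⟨C', hC0, hC'⟩ := hφ.exists_bound
    refine (hN.norm.const_mul (C' * C)).mono' ?_ (Eventually.of_forall fun y => ?_)
    · refine hφ.smooth.continuous.aestronglyMeasurable.mul ?_
      exact (ContinuousLinearMap.apply ℝ ℝ).flip.aestronglyMeasurable_comp₂
        hcont.aestronglyMeasurable hN.1
    · rw [norm_mul, mul_assoc]
      exact mul_le_mul (hC' y) ((le_opNorm _ _).trans (mul_le_mul_of_nonneg_right (hC _)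
        (norm_nonneg _))) (norm_nonneg _) hC0
  simp only [h4] at h3
  rw [integral_sub (hρint hNφ) hφN] at h3
  have h5 : mollify m (Ω.indicator fun z => φ z * d z + inner ℝ (N z) (∇ φ z)) x =
      ∫ y in Ω, mollifier n m (x - y) * (φ y * d y + inner ℝ (N y) (∇ φ y)) := by
    rw [mollify_apply, ← integral_indicator hm]
    refine integral_congr_ae (Eventually.of_forall fun y => ?_)
    by_cases hy : y ∈ Ω
    · simp [hy]
    · simp [hy]
  rw [h1, h5]
  simp only [mul_add]
  have hφd : IntegrableOn (fun y => φ y * d y) Ω := hφ.integrable_smul hd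
  rw [integral_add (hρint hφd) (hρint hNφ)]
  have h6 : ∫ y in Ω, d y * (φ y * mollifier n m (x - y)) =
      ∫ y in Ω, mollifier n m (x - y) * (φ y * d y) :=
    integral_congr_ae (Eventually.of_forall fun y => by ring)
  linarith

lemma isTestFunction_mollify {f : Euc n → ℝ} (hf : LocallyIntegrable f) {K : Set (Euc n)}
    (hK : IsCompact K) (hfK : Function.support f ⊆ K) {m : ℕ}
    (hm : cthickening (bump n m).rOut K ⊆ Ω) : IsTestFunction Ω (mollify m f) where
  smooth := contDiff_mollify m hf
  compactSupport := hK.cthickening.of_isClosed_subset (isClosed_tsupport _)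
    (tsupport_mollify_subset m hfK)
  support_subset := (tsupport_mollify_subset m hfK).trans hm

/-- Each coordinate of the mollified `φ N` is a test function, so the gradient identity applies
coordinatewise; summing gives `∫ u div = -⟨Du, ·⟩` with `Du = τ ν - F dx`. -/
lemma integral_mul_mollify {φ u d : Euc n → ℝ} (hφ : IsTestFunction Ω φ) (hm : MeasurableSet Ω)
    {N F τ : Euc n → Euc n} {ν : Measure (Euc n)}
    (hN : IntegrableOn N Ω) (hd : IntegrableOn d Ω) (hdiv : IsWeakDivergence Ω N d)
    (hu : IntegrableOn u Ω) (hτ : Integrable τ ν) (hF : IntegrableOn F Ω)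
    (hgrad : ∀ ψ, IsTestFunction Ω ψ →
      ∫ x in Ω, u x • ∇ ψ x = -(∫ x, ψ x • τ x ∂ν - ∫ x in Ω, ψ x • F x))
    {m : ℕ} (hmΩ : cthickening (bump n m).rOut (tsupport φ) ⊆ Ω) :
    ∫ x in Ω, u x * mollify m (Ω.indicator fun z => φ z * d z + inner ℝ (N z) (∇ φ z)) x =
      -(∫ x, inner ℝ (mollify m (Ω.indicator fun z => φ z • N z) x) (τ x) ∂ν
        - ∫ x in Ω, inner ℝ (mollify m (Ω.indicator fun z => φ z • N z) x) (F x)) := by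
  simp only [← sum_fderiv_mollify hφ hm hN hd hdiv m]
  set W : Euc n → Euc n := Ω.indicator fun z => φ z • N z with hW
  have hWi : Integrable W := (integrable_indicator_iff hm).2 (hφ.integrable_smul hN)
  have hWic : ∀ i, Integrable fun y => W y i := fun i =>
    (EuclideanSpace.proj (𝕜 := ℝ) i).integrable_comp hWi
  have hsupp : ∀ i, Function.support (fun y => W y i) ⊆ tsupport φ := fun i y hy => by
    refine subset_tsupport φ fun h0 => hy ?_
    by_cases hyΩ : y ∈ Ω <;> simp [hW, hyΩ, h0]
  have htest : ∀ i, IsTestFunction Ω (mollify m fun y => W y i) := fun i =>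
    isTestFunction_mollify (hWic i).locallyIntegrable hφ.compactSupport (hsupp i) hmΩ
  have hcoord : ∀ {f : Euc n → Euc n} {μ : Measure (Euc n)} (i : Fin n), Integrable f μ →
      Integrable (fun x => mollify m (fun y => W y i) x * f x i) μ := fun {f μ} i hf =>
    (htest i).integrable_smul ((EuclideanSpace.proj (𝕜 := ℝ) i).integrable_comp hf)
  have hinner : ∀ {f : Euc n → Euc n} {μ : Measure (Euc n)}, Integrable f μ →
      ∫ x, inner ℝ (mollify m W x) (f x) ∂μ =
        ∑ i, ∫ x, mollify m (fun y => W y i) x * f x i ∂μ := fun {f μ} hf => by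
    rw [← integral_finsetSum _ fun i _ => hcoord i hf]
    refine integral_congr_ae (Eventually.of_forall fun x => ?_)
    simp [PiLp.inner_apply, mollify_coord m hWi.locallyIntegrable, mul_comm]
  have hgi : ∀ i, ∫ x in Ω, u x * fderiv ℝ (mollify m fun y => W y i) x
      (EuclideanSpace.single i 1) = -(∫ x, mollify m (fun y => W y i) x * τ x i ∂ν
        - ∫ x in Ω, mollify m (fun y => W y i) x * F x i) := fun i => by
    have h1 := congrArg (EuclideanSpace.proj (𝕜 := ℝ) i) (hgrad _ (htest i))
    rw [map_neg, map_sub, ← integral_comp_comm _ ((htest i).integrable_smul_gradient hu),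
      ← integral_comp_comm _ ((htest i).integrable_smul hτ),
      ← integral_comp_comm _ ((htest i).integrable_smul hF)] at h1
    simp only [map_smul, PiLp.proj_apply, smul_eq_mul] at h1
    rw [← h1]
    refine integral_congr_ae (Eventually.of_forall fun x => ?_)
    simp [gradient_apply]
  rw [hinner hτ, hinner hF, ← Finset.sum_sub_distrib, ← Finset.sum_neg_distrib,
    ← Finset.sum_congr rfl fun i _ => hgi i, ← integral_finsetSum]
  · simp only [Finset.mul_sum]
  · intro i _
    have := (htest i).integrable_smul_gradient hu
    refine ((EuclideanSpace.proj (𝕜 := ℝ) i).integrable_comp this).congr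
      (Eventually.of_forall fun x => ?_)
    simp [gradient_apply]

end MollifiedFields

/-! ### Identifying `N` with the polar density -/

section PolarDensity

variable {n : ℕ} {Ω : Set (Euc n)}

lemma exists_testFunction (hΩ : IsOpen Ω) {x : Euc n} (hx : x ∈ Ω) :
    ∃ φ, IsTestFunction Ω φ ∧ (∀ y, 0 ≤ φ y) ∧ φ x = 1 := by
  obtain ⟨φ, h1, h2, h3, h4, h5⟩ := exists_contDiff_tsupport_subset (n := ⊤) (hΩ.mem_nhds hx)
  exact ⟨φ, ⟨h3, h2, h1⟩, fun y => (h4 (mem_range_self y)).1, h5⟩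

/-- A nonnegative function whose integrals against nonnegative test functions are nonpositive
vanishes almost everywhere. -/
lemma ae_eq_zero_of_integral_testFunction_le (hΩ : IsOpen Ω) {ν : Measure (Euc n)}
    (hν : ν Ωᶜ = 0) {f : Euc n → ℝ} (hf : Integrable f ν) (hf0 : ∀ᵐ x ∂ν, 0 ≤ f x)
    (h : ∀ φ, IsTestFunction Ω φ → (∀ x, 0 ≤ φ x) → ∫ x, φ x * f x ∂ν ≤ 0) :
    ∀ᵐ x ∂ν, f x = 0 := by
  have key : ν {x | x ∈ Ω ∧ f x ≠ 0} = 0 := by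
    refine measure_null_of_locally_null _ fun x hx => ?_
    obtain ⟨φ, hφ, hφ0, hφx⟩ := exists_testFunction hΩ hx.1
    have h1 : 0 ≤ᵐ[ν] fun x => φ x * f x := by
      filter_upwards [hf0] with y hy using mul_nonneg (hφ0 y) hy
    have h2 := (integral_eq_zero_iff_of_nonneg_ae h1 (hφ.integrable_smul hf)).1
      (le_antisymm (h φ hφ hφ0) (integral_nonneg_of_ae h1))
    have hV : IsOpen {y | 0 < φ y} := isOpen_lt continuous_const hφ.smooth.continuous
    refine ⟨{x | x ∈ Ω ∧ f x ≠ 0} ∩ {y | 0 < φ y},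
      inter_mem_nhdsWithin _ (hV.mem_nhds (by simp [hφx])), ?_⟩
    refine measure_mono_null (fun y hy => ?_) h2
    exact mul_ne_zero (ne_of_gt hy.2) hy.1.2
  rw [ae_iff]
  refine measure_mono_null (fun x hx => ?_) (measure_union_null hν key)
  by_cases hxΩ : x ∈ Ω
  · exact Or.inr ⟨hxΩ, hx⟩
  · exact Or.inl hxΩ

/-- The Anzellotti pairing identity forces the calibrating field to be the polar density: off a
Lebesgue null set, `N = τ` almost everywhere for `ν`, and `τ` has norm one. -/
theorem ae_eq_of_pairing_eq (hΩ : IsOpen Ω) (hb : Bornology.IsBounded Ω)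
    {u d : Euc n → ℝ} {N F τ : Euc n → Euc n} {ν : Measure (Euc n)} [IsFiniteMeasure ν]
    (hν : ν Ωᶜ = 0) (hNm : StronglyMeasurable N) (hN : ∀ᵐ x ∂(volume.restrict Ω), ‖N x‖ ≤ 1)
    (hdm : AEStronglyMeasurable d (volume.restrict Ω)) {c : ℝ} (hc : 0 ≤ c)
    (hd : ∀ᵐ x ∂(volume.restrict Ω), ‖d x‖ ≤ c) (hdiv : IsWeakDivergence Ω N d)
    (hu : IntegrableOn u Ω) (hτm : StronglyMeasurable τ) (hτ : ∀ᵐ x ∂ν, ‖τ x‖ ≤ 1)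
    (hF : IntegrableOn F Ω)
    (hgrad : ∀ ψ, IsTestFunction Ω ψ →
      ∫ x in Ω, u x • ∇ ψ x = -(∫ x, ψ x • τ x ∂ν - ∫ x in Ω, ψ x • F x))
    (hcal : ∀ φ, IsTestFunction Ω φ →
      pairing Ω N d u φ + ∫ x in Ω, φ x * inner ℝ (N x) (F x) = ∫ x, φ x ∂ν) :
    (∀ᵐ x ∂ν, ‖τ x‖ = 1) ∧
      ∃ Z, MeasurableSet Z ∧ volume Z = 0 ∧ ∀ᵐ x ∂ν, x ∉ Z → N x = τ x := by
  classical
  have hm := hΩ.measurableSet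
  have hfin : IsFiniteMeasure (volume.restrict Ω) := ⟨by simpa using hb.measure_lt_top⟩
  have hNi : IntegrableOn N Ω := Integrable.of_bound hNm.aestronglyMeasurable 1 hN
  have hdi : IntegrableOn d Ω := Integrable.of_bound hdm c hd
  have hτi : Integrable τ ν := Integrable.of_bound hτm.aestronglyMeasurable 1 hτ
  -- On `S` the measure `ν` is absolutely continuous; `Sᶜ` is Lebesgue null and carries the singular
  -- part, where the values of `N` mean nothing.
  obtain ⟨S, hS, hνS, hvS⟩ := Measure.mutuallySingular_singularPart ν (volume : Measure (Euc n))
  have hac : ν.restrict S ≪ volume := by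
    rw [Measure.haveLebesgueDecomposition_add ν volume, Measure.restrict_add]
    refine Measure.AbsolutelyContinuous.add_left ?_ ?_
    · rw [Measure.restrict_eq_zero.2 hνS]
      exact Measure.AbsolutelyContinuous.zero _
    · exact Measure.restrict_le_self.absolutelyContinuous.trans
        (withDensity_absolutelyContinuous _ _)
  have hνΩ : ∀ᵐ x ∂ν, x ∈ Ω := by rwa [ae_iff]
  have htransfer : ∀ {p : Euc n → Prop}, (∀ᵐ x, p x) → ∀ᵐ x ∂ν, x ∈ S → p x := fun {p} hp =>
    (ae_restrict_iff' hS).1 (hac.ae_le hp)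
  have hNS : ∀ᵐ x ∂ν, x ∈ S → ‖N x‖ ≤ 1 := by
    filter_upwards [htransfer ((ae_restrict_iff' hm).1 hN), hνΩ] with x hx hxΩ hxS
    exact hx hxS hxΩ
  -- The largest density the mollified pairing can produce: the true one on `S`, and on `Sᶜ` only
  -- the bound coming from `|N| ≤ 1`.
  let h : Euc n → ℝ := S.piecewise (fun x => inner ℝ (N x) (τ x)) fun x => ‖τ x‖
  have hhm : StronglyMeasurable h :=
    StronglyMeasurable.piecewise hS (hNm.inner hτm) hτm.norm
  have hh1 : ∀ᵐ x ∂ν, h x ≤ 1 := by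
    filter_upwards [hτ, hNS] with x h1 h2
    by_cases hx : x ∈ S
    · simp only [h, piecewise_eq_of_mem _ _ _ hx]
      refine (real_inner_le_norm _ _).trans (mul_le_one₀ (h2 hx) (norm_nonneg _) h1)
    · simpa only [h, piecewise_eq_of_notMem _ _ _ hx] using h1
  have hh2 : ∀ᵐ x ∂ν, ‖h x‖ ≤ 1 := by
    filter_upwards [hτ, hNS] with x h1 h2
    by_cases hx : x ∈ S
    · simp only [h, piecewise_eq_of_mem _ _ _ hx]
      refine (norm_inner_le_norm _ _).trans (mul_le_one₀ (h2 hx) (norm_nonneg _) h1)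
    · simpa only [h, piecewise_eq_of_notMem _ _ _ hx, norm_norm] using h1
  have hhi : Integrable h ν := Integrable.of_bound hhm.aestronglyMeasurable 1 hh2
  -- Insert the mollified `φ N` as a test field and let the scale tend to zero. The left side
  -- recovers the pairing plus `∫ φ N · F`, which equals `∫ φ dν` by `hcal`.
  have hle : ∀ φ, IsTestFunction Ω φ → (∀ x, 0 ≤ φ x) →
      ∫ x, φ x ∂ν ≤ ∫ x, φ x * h x ∂ν := by
    intro φ hφ hφ0
    obtain ⟨C, hC0, hC⟩ := hφ.exists_bound
    obtain ⟨C', hC0', hC'⟩ := hφ.exists_gradient_bound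
    set W : Euc n → Euc n := Ω.indicator fun z => φ z • N z with hW
    set g : Euc n → ℝ := Ω.indicator fun z => φ z * d z + inner ℝ (N z) (∇ φ z) with hg
    have hWi : Integrable W := (integrable_indicator_iff hm).2 (hφ.integrable_smul hNi)
    have hNg : IntegrableOn (fun x => inner ℝ (N x) (∇ φ x)) Ω := by
      refine Integrable.of_bound
        (hNm.aestronglyMeasurable.inner hφ.continuous_gradient.aestronglyMeasurable) C' ?_
      filter_upwards [hN] with x hx
      refine (norm_inner_le_norm _ _).trans ?_
      exact (mul_le_of_le_one_left (norm_nonneg _) hx).trans (hC' x)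
    have hφd : IntegrableOn (fun x => φ x * d x) Ω := hφ.integrable_smul hdi
    have hgi : Integrable g := (integrable_indicator_iff hm).2 (hφd.add hNg)
    have hWφ : ∀ᵐ x, ‖W x‖ ≤ φ x := by
      filter_upwards [(ae_restrict_iff' hm).1 hN] with x hx
      by_cases hxΩ : x ∈ Ω
      · rw [hW, indicator_of_mem hxΩ, norm_smul, Real.norm_of_nonneg (hφ0 x)]
        exact mul_le_of_le_one_right (hφ0 x) (hx hxΩ)
      · rw [hW, indicator_of_notMem hxΩ, norm_zero]
        exact hφ0 x
    have hWC : ∀ᵐ x, ‖W x‖ ≤ C := by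
      filter_upwards [hWφ] with x hx
      exact hx.trans ((le_abs_self _).trans (hC x))
    have hgC : ∀ᵐ x, ‖g x‖ ≤ C * c + C' := by
      filter_upwards [(ae_restrict_iff' hm).1 hN, (ae_restrict_iff' hm).1 hd] with x hx hx'
      by_cases hxΩ : x ∈ Ω
      · rw [hg, indicator_of_mem hxΩ]
        refine (norm_add_le _ _).trans (add_le_add ?_ ?_)
        · rw [norm_mul]
          exact mul_le_mul (hC x) (hx' hxΩ) (norm_nonneg _) hC0
        · refine (norm_inner_le_norm _ _).trans ?_
          exact (mul_le_of_le_one_left (norm_nonneg _) (hx hxΩ)).trans (hC' x)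
      · rw [hg, indicator_of_notMem hxΩ, norm_zero]
        positivity
    have hcG : ∀ m, Continuous (mollify m g) := fun m =>
      (contDiff_mollify m hgi.locallyIntegrable).continuous
    have hcW : ∀ m, Continuous (mollify m W) := fun m =>
      (contDiff_mollify m hWi.locallyIntegrable).continuous
    have hφloc : LocallyIntegrable φ := hφ.smooth.continuous.locallyIntegrable
    have hcφ : ∀ m, Continuous (mollify m φ) := fun m => (contDiff_mollify m hφloc).continuous
    have hWm : ∀ m x, ‖mollify m W x‖ ≤ C := fun m x => norm_mollify_le m hWC x
    have lim1 : Tendsto (fun m => ∫ x in Ω, u x * mollify m g x) atTop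
        (𝓝 (∫ x in Ω, u x * g x)) := by
      refine tendsto_integral_of_dominated_convergence (fun x => ‖u x‖ * (C * c + C'))
        (fun m => hu.1.mul (hcG m).aestronglyMeasurable) (hu.norm.mul_const _) (fun m => ?_) ?_
      · refine Eventually.of_forall fun x => ?_
        rw [norm_mul]
        exact mul_le_mul_of_nonneg_left (norm_mollify_le m hgC x) (norm_nonneg _)
      · filter_upwards [ae_restrict_of_ae (ae_tendsto_mollify hgi.locallyIntegrable)] with x hx
        exact hx.const_mul _
    have lim2 : Tendsto (fun m => ∫ x in Ω, inner ℝ (mollify m W x) (F x)) atTop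
        (𝓝 (∫ x in Ω, inner ℝ (W x) (F x))) := by
      refine tendsto_integral_of_dominated_convergence (fun x => C * ‖F x‖)
        (fun m => (hcW m).aestronglyMeasurable.inner hF.1) (hF.norm.const_mul _) (fun m => ?_) ?_
      · refine Eventually.of_forall fun x => (norm_inner_le_norm _ _).trans ?_
        exact mul_le_mul_of_nonneg_right (hWm m x) (norm_nonneg _)
      · filter_upwards [ae_restrict_of_ae (ae_tendsto_mollify hWi.locallyIntegrable)] with x hx
        exact hx.inner tendsto_const_nhds
    -- Lebesgue points give convergence on `S`. On `Sᶜ` the field is replaced by its bound `ρ * φ`,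
    -- which converges everywhere since `φ` is continuous.
    let r : ℕ → Euc n → ℝ := fun m => S.piecewise (fun x => inner ℝ (mollify m W x) (τ x))
      fun x => mollify m φ x * ‖τ x‖
    have hrm : ∀ m, StronglyMeasurable (r m) := fun m =>
      StronglyMeasurable.piecewise hS ((hcW m).stronglyMeasurable.inner hτm)
        ((hcφ m).stronglyMeasurable.mul hτm.norm)
    have hrC : ∀ m, ∀ᵐ x ∂ν, ‖r m x‖ ≤ C := fun m => by
      filter_upwards [hτ] with x hx
      by_cases hxS : x ∈ S
      · simp only [r, piecewise_eq_of_mem _ _ _ hxS]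
        refine (norm_inner_le_norm _ _).trans ?_
        exact (mul_le_of_le_one_right (norm_nonneg _) hx).trans (hWm m x)
      · simp only [r, piecewise_eq_of_notMem _ _ _ hxS, norm_mul, norm_norm]
        exact (mul_le_of_le_one_right (norm_nonneg _) hx).trans
          (norm_mollify_le m (Eventually.of_forall hC) x)
    have lim3 : Tendsto (fun m => ∫ x, r m x ∂ν) atTop (𝓝 (∫ x, φ x * h x ∂ν)) := by
      refine tendsto_integral_of_dominated_convergence (fun _ => C)
        (fun m => (hrm m).aestronglyMeasurable) (integrable_const _) hrC ?_
      filter_upwards [htransfer (ae_tendsto_mollify hWi.locallyIntegrable), hνΩ] with x hx hxΩ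
      by_cases hxS : x ∈ S
      · simp only [r, h, piecewise_eq_of_mem _ _ _ hxS]
        have h1 := (hx hxS).inner (𝕜 := ℝ) (tendsto_const_nhds (x := τ x))
        rwa [hW, indicator_of_mem hxΩ, real_inner_smul_left] at h1
      · simp only [r, h, piecewise_eq_of_notMem _ _ _ hxS]
        exact (ContDiffBump.convolution_tendsto_right_of_continuous tendsto_bump_rOut
          hφ.smooth.continuous x).mul_const _
    have hrle : ∀ m, ∫ x, inner ℝ (mollify m W x) (τ x) ∂ν ≤ ∫ x, r m x ∂ν := fun m => by
      refine integral_mono_ae ?_ (Integrable.of_bound (hrm m).aestronglyMeasurable C (hrC m)) ?_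
      · refine Integrable.of_bound
          ((hcW m).aestronglyMeasurable.inner hτm.aestronglyMeasurable) C ?_
        filter_upwards [hτ] with x hx
        refine (norm_inner_le_norm _ _).trans ?_
        exact (mul_le_of_le_one_right (norm_nonneg _) hx).trans (hWm m x)
      · refine Eventually.of_forall fun x => ?_
        by_cases hxS : x ∈ S
        · simp only [r, piecewise_eq_of_mem _ _ _ hxS]
          exact le_rfl
        · simp only [r, piecewise_eq_of_notMem _ _ _ hxS]
          refine (real_inner_le_norm _ _).trans ?_
          exact mul_le_mul_of_nonneg_right (norm_mollify_le_mollify m hφloc hWφ x) (norm_nonneg _)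
    obtain ⟨δ, hδ, hδφ⟩ := hφ.compactSupport.isCompact.exists_cthickening_subset_open hΩ
      hφ.support_subset
    have hev : ∀ᶠ m in atTop, (bump n m).rOut ≤ δ := tendsto_bump_rOut.eventually (Iic_mem_nhds hδ)
    have hfinal : -(∫ x in Ω, u x * g x) + ∫ x in Ω, inner ℝ (W x) (F x) ≤
        ∫ x, φ x * h x ∂ν := by
      refine le_of_tendsto_of_tendsto (lim1.neg.add lim2) lim3 ?_
      filter_upwards [hev] with m hmδ
      have := integral_mul_mollify hφ hm hNi hdi hdiv hu hτi hF hgrad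
        ((cthickening_mono hmδ _).trans hδφ)
      rw [this]
      linarith [hrle m]
    have hugint : ∫ x in Ω, u x * g x =
        (∫ x in Ω, u x * φ x * d x) + ∫ x in Ω, u x * inner ℝ (N x) (∇ φ x) := by
      rw [← integral_add]
      · refine setIntegral_congr_fun hm fun x hx => ?_
        simp only [hg, indicator_of_mem hx]
        ring
      · refine (hu.norm.mul_const (C * c)).mono'
          ((hu.1.mul hφ.smooth.continuous.aestronglyMeasurable).mul hdm) ?_
        filter_upwards [hd] with x hx
        rw [norm_mul, norm_mul, mul_assoc]
        exact mul_le_mul_of_nonneg_left (mul_le_mul (hC x) hx (norm_nonneg _) hC0) (norm_nonneg _)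
      · refine (hu.norm.mul_const C').mono' (hu.1.mul hNg.1) ?_
        filter_upwards [hN] with x hx
        rw [norm_mul]
        refine mul_le_mul_of_nonneg_left ((norm_inner_le_norm _ _).trans ?_) (norm_nonneg _)
        exact (mul_le_of_le_one_left (norm_nonneg _) hx).trans (hC' x)
    have hWF : ∫ x in Ω, inner ℝ (W x) (F x) = ∫ x in Ω, φ x * inner ℝ (N x) (F x) := by
      refine setIntegral_congr_fun hm fun x hx => ?_
      simp only [hW, indicator_of_mem hx, real_inner_smul_left]
    have h1 := hcal φ hφ
    rw [pairing] at h1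
    rw [hugint, hWF] at hfinal
    linarith
  -- `1 - h` is nonnegative, while `hle` makes its integrals against nonnegative test functions
  -- nonpositive.
  have hone : ∀ᵐ x ∂ν, 1 - h x = 0 := by
    refine ae_eq_zero_of_integral_testFunction_le hΩ hν ((integrable_const 1).sub hhi) ?_ ?_
    · filter_upwards [hh1] with x hx using sub_nonneg.2 hx
    · intro φ hφ hφ0
      have hφh : Integrable (fun x => φ x * h x) ν := hφ.integrable_smul hhi
      simp only [mul_sub, mul_one]
      rw [integral_sub (hφ.integrable_of_bound ν) hφh]
      linarith [hle φ hφ hφ0]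
  refine ⟨?_, Sᶜ, hS.compl, hvS, ?_⟩
  · filter_upwards [hone, hτ, hNS] with x h1 h2 h3
    by_cases hx : x ∈ S
    · simp only [h, piecewise_eq_of_mem _ _ _ hx] at h1
      have h4 := real_inner_le_norm (N x) (τ x)
      have h5 := mul_le_of_le_one_left (norm_nonneg (τ x)) (h3 hx)
      linarith
    · simp only [h, piecewise_eq_of_notMem _ _ _ hx] at h1
      linarith
  · filter_upwards [hone, hτ, hNS] with x h1 h2 h3 hx
    rw [notMem_compl_iff] at hx
    simp only [h, piecewise_eq_of_mem _ _ _ hx] at h1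
    have h4 := norm_sub_sq_real (N x) (τ x)
    have h5 := h3 hx
    -- Equality in Cauchy-Schwarz: `N · τ = 1` with both norms at most `1`.
    have h6 : ‖N x - τ x‖ ^ 2 ≤ 0 := by
      nlinarith [norm_nonneg (N x), norm_nonneg (τ x)]
    have h7 : ‖N x - τ x‖ = 0 := by
      nlinarith [norm_nonneg (N x - τ x)]
    exact sub_eq_zero.1 (norm_eq_zero.1 h7)

end PolarDensity

/-! ### Integration against vector measures and test functions for `𝒟₀` -/

section H1Functions

variable {n : ℕ} {Ω : Set (Euc n)}

lemma integrable_inner_of_memLp {μ : Measure (Euc n)} {f g : Euc n → Euc n} (hf : MemLp f 2 μ)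
    (hg : MemLp g 2 μ) : Integrable (fun x => inner ℝ (f x) (g x)) μ := by
  refine (hf.norm.integrable_mul hg.norm).mono' (hf.1.inner hg.1) ?_
  exact Eventually.of_forall fun x => norm_inner_le_norm _ _

lemma isFiniteMeasure_variation_withDensityᵥ {μ : Measure (Euc n)} {f : Euc n → Euc n}
    (hf : Integrable f μ) : IsFiniteMeasure (μ.withDensityᵥ f).variation := by
  rw [Measure.variation_withDensityᵥ hf]
  exact ⟨by simpa [hasFiniteIntegral_iff_enorm] using hf.2⟩

lemma integral_simpleFunc_withDensityᵥ {μ : Measure (Euc n)} {f : Euc n → Euc n}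
    (hf : Integrable f μ) (φ : SimpleFunc (Euc n) ℝ) :
    VectorMeasure.integral (μ.withDensityᵥ f) φ (lsmul ℝ ℝ) = ∫ x, φ x • f x ∂μ := by
  classical
  have hfin := isFiniteMeasure_variation_withDensityᵥ hf
  have hi : ∀ ψ : SimpleFunc (Euc n) ℝ, (μ.withDensityᵥ f).Integrable ψ := fun ψ =>
    ψ.integrable_of_isFiniteMeasure
  have hi' : ∀ ψ : SimpleFunc (Euc n) ℝ, Integrable (fun x => ψ x • f x) μ := fun ψ => by
    obtain ⟨C, hC⟩ := ψ.exists_forall_norm_le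
    exact hf.bdd_smul C ψ.stronglyMeasurable.aestronglyMeasurable (Eventually.of_forall hC)
  induction φ using SimpleFunc.induction with
  | @const c s hs =>
    rw [SimpleFunc.coe_piecewise, SimpleFunc.coe_const, SimpleFunc.coe_const,
      Function.const_zero, Set.piecewise_eq_indicator, VectorMeasure.integral_indicator hs]
    have h1 : (fun x => s.indicator (Function.const (Euc n) c) x • f x) =
        s.indicator fun x => c • f x := by
      ext1 x
      by_cases hx : x ∈ s <;> simp [hx]
    rw [h1, integral_indicator hs, integral_smul]
    have h2 := VectorMeasure.setIntegral_const (μ := μ.withDensityᵥ f) (s := s)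
      (B := lsmul ℝ ℝ) c
    rw [withDensityᵥ_apply hf hs] at h2
    exact h2
  | @add φ ψ _ h1 h2 =>
    rw [SimpleFunc.coe_add, VectorMeasure.integral_add (hi φ) (hi ψ), h1, h2,
      ← integral_add (hi' φ) (hi' ψ)]
    simp only [Pi.add_apply, add_smul]

/-- Integration with respect to a vector measure with density. -/
lemma integral_withDensityᵥ {μ : Measure (Euc n)} {f : Euc n → Euc n} (hf : Integrable f μ)
    {φ : Euc n → ℝ} (hφ : StronglyMeasurable φ) {C : ℝ} (hC : 0 ≤ C) (hφC : ∀ x, ‖φ x‖ ≤ C) :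
    VectorMeasure.integral (μ.withDensityᵥ f) φ (lsmul ℝ ℝ) = ∫ x, φ x • f x ∂μ := by
  have hfin := isFiniteMeasure_variation_withDensityᵥ hf
  have h1 : Tendsto (fun k => VectorMeasure.integral (μ.withDensityᵥ f) (hφ.approxBounded C k)
      (lsmul ℝ ℝ)) atTop _ := VectorMeasure.tendsto_integral_of_dominated_convergence (μ := μ.withDensityᵥ f)
    (B := lsmul ℝ ℝ) (f := φ) (fun _ => C)
    (fun k => (hφ.approxBounded C k).stronglyMeasurable.aestronglyMeasurable)
    (integrable_const _) (fun k => Eventually.of_forall fun x => hφ.norm_approxBounded_le hC k x)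
    (Eventually.of_forall fun x => hφ.tendsto_approxBounded_of_norm_le (hφC x))
  have h2 : Tendsto (fun k => ∫ x, hφ.approxBounded C k x • f x ∂μ) atTop
      (𝓝 (∫ x, φ x • f x ∂μ)) := by
    refine tendsto_integral_of_dominated_convergence (fun x => C * ‖f x‖)
      (fun k => (hφ.approxBounded C k).stronglyMeasurable.aestronglyMeasurable.smul hf.1)
      (hf.norm.const_mul C) (fun k => Eventually.of_forall fun x => ?_)
      (Eventually.of_forall fun x => (hφ.tendsto_approxBounded_of_norm_le (hφC x)).smul_const _)
    rw [norm_smul]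
    exact mul_le_mul_of_nonneg_right (hφ.norm_approxBounded_le hC k x) (norm_nonneg _)
  simp only [integral_simpleFunc_withDensityᵥ hf] at h1
  exact tendsto_nhds_unique h1 h2

/-- Integration by parts against the constant `1`. It puts constants in `H¹(Ω)` with gradient zero,
as needed to adjust mean values. -/
lemma integral_gradient_eq_zero {ψ : Euc n → ℝ} (hψ : IsTestFunction Ω ψ) :
    ∫ x in Ω, ∇ ψ x = 0 := by
  have hcs : HasCompactSupport (fderiv ℝ ψ) := hψ.compactSupport.fderiv ℝ
  have hsub : Function.support (∇ ψ) ⊆ tsupport ψ := fun x hx => by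
    refine support_fderiv_subset ℝ (fun h => hx ?_)
    simp only [gradient, h, map_zero]
  have hint : Integrable (∇ ψ) :=
    hψ.continuous_gradient.integrable_of_hasCompactSupport
      (HasCompactSupport.intro' hψ.compactSupport (isClosed_tsupport _)
        fun x hx => by_contra fun h => hx (hsub h))
  rw [setIntegral_eq_integral_of_forall_compl_eq_zero
    (fun x hx => by_contra fun h => hx (hψ.support_subset (hsub h)))]
  refine ext_inner_right ℝ fun v => ?_
  rw [inner_zero_left, real_inner_comm, ← integral_inner hint]
  simp only [real_inner_comm _ v, inner_gradient]
  have hv : Integrable fun x => fderiv ℝ ψ x v := by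
    simpa only [real_inner_comm _ v, inner_gradient] using hint.const_inner (𝕜 := ℝ) v
  have h := integral_smul_fderiv_eq_neg_fderiv_smul_of_integrable (μ := volume) (𝕜 := ℝ)
    (f := fun _ : Euc n => (1 : ℝ)) (g := ψ) (v := v) (by simp) (by simpa using hv)
    (by simpa using hψ.smooth.continuous.integrable_of_hasCompactSupport hψ.compactSupport)
    (fun x _ => differentiableAt_const _) fun x _ => hψ.smooth.differentiable (by simp) x
  simpa using h

lemma hasH1Gradient_const (hb : Bornology.IsBounded Ω) (c : ℝ) :
    HasH1Gradient Ω (fun _ => c) 0 where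
  memLp := by
    have : IsFiniteMeasure (volume.restrict Ω) := ⟨by simpa using hb.measure_lt_top⟩
    exact memLp_const c
  memLp_grad := MemLp.zero
  isWeakGradient φ hφ := by
    rw [integral_smul, integral_gradient_eq_zero hφ]
    simp

lemma HasH1Gradient.add (hb : Bornology.IsBounded Ω) {u v : Euc n → ℝ} {G G' : Euc n → Euc n}
    (hu : HasH1Gradient Ω u G) (hv : HasH1Gradient Ω v G') :
    HasH1Gradient Ω (u + v) (G + G') where
  memLp := hu.memLp.add hv.memLp
  memLp_grad := hu.memLp_grad.add hv.memLp_grad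
  isWeakGradient := by
    have : IsFiniteMeasure (volume.restrict Ω) := ⟨by simpa using hb.measure_lt_top⟩
    exact hu.isWeakGradient.add hv.isWeakGradient (hu.memLp.integrable one_le_two)
      (hv.memLp.integrable one_le_two) (hu.memLp_grad.integrable one_le_two)
      (hv.memLp_grad.integrable one_le_two)

lemma HasH1Gradient.const_smul {u : Euc n → ℝ} {G : Euc n → Euc n}
    (hu : HasH1Gradient Ω u G) (c : ℝ) : HasH1Gradient Ω (c • u) (c • G) where
  memLp := hu.memLp.const_smul c
  memLp_grad := hu.memLp_grad.const_smul c
  isWeakGradient := hu.isWeakGradient.const_smul c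

lemma IsTestFunction.mul {φ ψ : Euc n → ℝ} (hφ : IsTestFunction Ω φ)
    (hψ : IsTestFunction Ω ψ) : IsTestFunction Ω fun x => φ x * ψ x where
  smooth := hφ.smooth.mul hψ.smooth
  compactSupport := hφ.compactSupport.mul_right
  support_subset := (tsupport_mul_subset_left).trans hφ.support_subset

/-- The product rule, obtained by testing the weak gradient of `u` with `φ ψ`. -/
lemma HasH1Gradient.mul_testFunction (hb : Bornology.IsBounded Ω) {u φ : Euc n → ℝ}
    {G : Euc n → Euc n} (hu : HasH1Gradient Ω u G) (hφ : IsTestFunction Ω φ) :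
    HasH1Gradient Ω (fun x => φ x * u x) fun x => φ x • G x + u x • ∇ φ x := by
  have hfin : IsFiniteMeasure (volume.restrict Ω) := ⟨by simpa using hb.measure_lt_top⟩
  obtain ⟨C, hC0, hC⟩ := hφ.exists_bound
  obtain ⟨C', hC0', hC'⟩ := hφ.exists_gradient_bound
  have hφm := hφ.smooth.continuous.aestronglyMeasurable (μ := volume.restrict Ω)
  have hgm := hφ.continuous_gradient.aestronglyMeasurable (μ := volume.restrict Ω)
  have hui := hu.memLp.integrable one_le_two
  have hGi := hu.memLp_grad.integrable one_le_two
  refine ⟨hu.memLp.of_le_mul (c := C) (hφm.mul hu.memLp.1) ?_, ?_, fun ψ hψ => ?_⟩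
  · refine Eventually.of_forall fun x => ?_
    rw [norm_mul]
    exact mul_le_mul_of_nonneg_right (hC x) (norm_nonneg _)
  · refine (hu.memLp_grad.of_le_mul (c := C) (hφm.smul hu.memLp_grad.1) ?_).add
      (hu.memLp.of_le_mul (c := C') (hu.memLp.1.smul hgm) ?_)
    · refine Eventually.of_forall fun x => ?_
      rw [Pi.smul_apply', norm_smul]
      exact mul_le_mul_of_nonneg_right (hC x) (norm_nonneg _)
    · refine Eventually.of_forall fun x => ?_
      rw [norm_smul, mul_comm]
      exact mul_le_mul_of_nonneg_right (hC' x) (norm_nonneg _)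
  · have h1 := hu.isWeakGradient _ (hφ.mul hψ)
    have h2 : ∀ x, u x • ∇ (fun x => φ x * ψ x) x =
        (φ x * u x) • ∇ ψ x + ψ x • (u x • ∇ φ x) := fun x => by
      rw [gradient_mul (hφ.smooth.differentiable (by simp) x)
        (hψ.smooth.differentiable (by simp) x), smul_add, smul_smul, smul_smul, smul_smul,
        mul_comm (u x), mul_comm (u x)]
    have i1 : Integrable (fun x => (φ x * u x) • ∇ ψ x) (volume.restrict Ω) :=
      hψ.integrable_smul_gradient (hφ.integrable_smul hui)
    have i2 : Integrable (fun x => ψ x • (u x • ∇ φ x)) (volume.restrict Ω) :=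
      hψ.integrable_smul (hφ.integrable_smul_gradient hui)
    have i3 : Integrable (fun x => ψ x • φ x • G x) (volume.restrict Ω) :=
      hψ.integrable_smul (hφ.integrable_smul hGi)
    simp only [h2] at h1
    rw [integral_add i1 i2] at h1
    simp only [smul_add]
    rw [integral_add i3 i2, eq_sub_of_add_eq h1]
    simp only [smul_smul, mul_comm]
    abel

/-- The weak formulation defining `𝒟₀`, tested against functions of arbitrary mean. -/
lemma integral_inner_eq_of_mem_DZero (hΩ : IsOpen Ω) (hne : Ω.Nonempty)
    (hb : Bornology.IsBounded Ω) {H v : Euc n → ℝ} {N G : Euc n → Euc n} (hN : N ∈ DZero Ω H)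
    (hH : MemLp H 2 (volume.restrict Ω)) (hv : HasH1Gradient Ω v G) :
    ∫ x in Ω, inner ℝ (N x) (G x) = -∫ x in Ω, (H x - ⨍ y in Ω, H y) * v x := by
  have hfin : IsFiniteMeasure (volume.restrict Ω) := ⟨by simpa using hb.measure_lt_top⟩
  have hvi := hv.memLp.integrable one_le_two
  have hHi := hH.integrable one_le_two
  have hHv : Integrable (fun x => H x * v x) (volume.restrict Ω) := hH.integrable_mul hv.memLp
  -- Testing with `v - m` is allowed; the constant moves onto `H` as the subtraction of its mean.
  set m := ⨍ y in Ω, v y with hm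
  have hw := hv.add hb (hasH1Gradient_const hb (-m))
  have hpos : volume.real Ω ≠ 0 :=
    (ENNReal.toReal_pos (hΩ.measure_pos volume hne).ne' hb.measure_lt_top.ne).ne'
  have hmv : ∫ x in Ω, v x = volume.real Ω * m := by
    rw [hm, setAverage_eq, smul_eq_mul, mul_inv_cancel_left₀ hpos]
  have hmH : ∫ x in Ω, H x = volume.real Ω * ⨍ y in Ω, H y := by
    rw [setAverage_eq, smul_eq_mul, mul_inv_cancel_left₀ hpos]
  have h0 : ∫ x in Ω, (v + fun _ : Euc n => -m) x = 0 := by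
    simp only [Pi.add_apply]
    rw [integral_add hvi (integrable_const _), hmv, integral_const]
    simp
  have h1 := hN.2 _ _ hw h0
  have i1 : Integrable (fun x => inner ℝ (G x) (N x)) (volume.restrict Ω) :=
    integrable_inner_of_memLp hv.memLp_grad hN.1
  have h2 : ∀ x, inner ℝ ((G + 0) x) (N x) + H x * (v + fun _ : Euc n => -m) x =
      inner ℝ (G x) (N x) + (H x * v x - H x * m) := fun x => by
    simp only [Pi.add_apply, Pi.zero_apply, add_zero]
    ring
  simp only [h2] at h1
  have i2 : Integrable (fun x => H x * v x - H x * m) (volume.restrict Ω) :=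
    hHv.sub (hHi.mul_const m)
  rw [integral_add i1 i2, integral_sub hHv (hHi.mul_const m),
    integral_mul_const, hmH] at h1
  simp only [sub_mul, real_inner_comm] at h1 ⊢
  rw [integral_sub hHv (hvi.const_mul _), integral_const_mul, hmv]
  linarith

/-- Test the weak formulation with `φ · 1`. -/
lemma isWeakDivergence_of_mem_DZero (hΩ : IsOpen Ω) (hne : Ω.Nonempty)
    (hb : Bornology.IsBounded Ω) {H : Euc n → ℝ} {N : Euc n → Euc n} (hN : N ∈ DZero Ω H)
    (hH : MemLp H 2 (volume.restrict Ω)) :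
    IsWeakDivergence Ω N fun x => H x - ⨍ y in Ω, H y := fun φ hφ => by
  have h := integral_inner_eq_of_mem_DZero hΩ hne hb hN hH
    ((hasH1Gradient_const hb 1).mul_testFunction hb hφ)
  simpa using h

/-- Test the weak formulation with `φ u`; the term `u N · ∇φ` of the product rule cancels the one in
the pairing. -/
lemma pairing_eq_of_mem_DZero (hΩ : IsOpen Ω) (hne : Ω.Nonempty)
    (hb : Bornology.IsBounded Ω) {H u φ : Euc n → ℝ} {N G : Euc n → Euc n} (hN : N ∈ DZero Ω H)
    (hH : MemLp H 2 (volume.restrict Ω)) (hu : HasH1Gradient Ω u G) (hφ : IsTestFunction Ω φ) :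
    pairing Ω N (fun x => H x - ⨍ y in Ω, H y) u φ = ∫ x in Ω, φ x * inner ℝ (N x) (G x) := by
  have h := integral_inner_eq_of_mem_DZero hΩ hne hb hN hH (hu.mul_testFunction hb hφ)
  have i1 : Integrable (fun x => φ x * inner ℝ (N x) (G x)) (volume.restrict Ω) :=
    hφ.integrable_smul (integrable_inner_of_memLp hN.1 hu.memLp_grad)
  have i2 : Integrable (fun x => u x * inner ℝ (N x) (∇ φ x)) (volume.restrict Ω) := by
    obtain ⟨C', hC0', hC'⟩ := hφ.exists_gradient_bound
    have : MemLp (fun x => u x • ∇ φ x) 2 (volume.restrict Ω) := by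
      refine hu.memLp.of_le_mul (c := C')
        (hu.memLp.1.smul hφ.continuous_gradient.aestronglyMeasurable) ?_
      refine Eventually.of_forall fun x => ?_
      rw [norm_smul, mul_comm]
      exact mul_le_mul_of_nonneg_right (hC' x) (norm_nonneg _)
    simpa only [real_inner_smul_right] using integrable_inner_of_memLp hN.1 this
  simp only [inner_add_right, real_inner_smul_right] at h
  rw [integral_add i1 i2] at h
  rw [pairing, eq_sub_of_add_eq h]
  congr 2
  refine integral_congr_ae (Eventually.of_forall fun x => ?_)
  simp only
  ring

end H1Functions

/-! ### Calibrated minimizing sequences and their limits -/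

section Existence

variable {n : ℕ} {Ω : Set (Euc n)}

/-- A field `N ∈ 𝒟₀` together with a sequence of Sobolev functions that it calibrates
asymptotically, bounded in `W^{1,1}`. -/
theorem exists_calibrated_sequence (hb : Bornology.IsBounded Ω) {C : ℝ} (hC : 0 < C)
    (hP : ∀ v G, HasH1Gradient Ω v G → ∫ x in Ω, v x = 0 →
      ∫ x in Ω, ‖v x‖ ≤ C * ∫ x in Ω, ‖G x‖) {F : Euc n → Euc n} {H : Euc n → ℝ} {θ : ℝ}
    (hF : MemLp F 2 (volume.restrict Ω)) (hHm : AEStronglyMeasurable H (volume.restrict Ω))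
    (hθ : 0 ≤ θ) (hHθ : ∀ᵐ x ∂(volume.restrict Ω), ‖H x‖ ≤ θ) (hθC : θ * C < 1) :
    ∃ N, StronglyMeasurable N ∧ (∀ᵐ x ∂(volume.restrict Ω), ‖N x‖ ≤ 1) ∧ N ∈ DZero Ω H ∧
      ∃ (u : ℕ → Euc n → ℝ) (G : ℕ → Euc n → Euc n) (M : ℝ),
        (∀ k, HasH1Gradient Ω (u k) (G k)) ∧ (∀ k, ∫ x in Ω, ‖u k x‖ ≤ M) ∧
        (∀ k, ∫ x in Ω, ‖G k x‖ ≤ M) ∧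
        Tendsto (fun k => ∫ x in Ω, (‖G k x + F x‖ - inner ℝ (N x) (G k x + F x)))
          atTop (𝓝 0) := by
  have hfin : IsFiniteMeasure (volume.restrict Ω) := ⟨by simpa using hb.measure_lt_top⟩
  have hH2 : MemLp H 2 (volume.restrict Ω) := MemLp.of_bound hHm θ hHθ
  -- Functions are paired with their weak gradients, so that taking the gradient is the linear
  -- second projection.
  let X : Submodule ℝ ((Euc n → ℝ) × (Euc n → Euc n)) :=
    { carrier := {p | HasH1Gradient Ω p.1 p.2 ∧ ∫ x in Ω, p.1 x = 0}
      add_mem' := by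
        rintro p q ⟨hp, hp0⟩ ⟨hq, hq0⟩
        refine ⟨hp.add hb hq, ?_⟩
        simp only [Prod.fst_add, Pi.add_apply]
        rw [integral_add (hp.memLp.integrable one_le_two) (hq.memLp.integrable one_le_two), hp0,
          hq0, add_zero]
      zero_mem' := ⟨hasH1Gradient_const hb 0, by simp⟩
      smul_mem' := by
        rintro c p ⟨hp, hp0⟩
        refine ⟨hp.const_smul c, ?_⟩
        simp only [Prod.smul_fst, Pi.smul_apply]
        rw [integral_smul, hp0, smul_zero] }
  have hHv : ∀ x : X, Integrable (fun y => H y * x.1.1 y) (volume.restrict Ω) := fun x =>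
    hH2.integrable_mul x.2.1.memLp
  let A : X →ₗ[ℝ] (Euc n → Euc n) := (LinearMap.snd ℝ _ _).comp X.subtype
  let l : X →ₗ[ℝ] ℝ :=
    { toFun := fun x => -∫ y in Ω, H y * x.1.1 y
      map_add' := fun x y => by
        rw [← neg_add, ← integral_add (hHv x) (hHv y)]
        simp only [Submodule.coe_add, Prod.fst_add, Pi.add_apply, mul_add]
      map_smul' := fun c x => by
        simp only [Submodule.coe_smul, Prod.smul_fst, Pi.smul_apply, smul_eq_mul, RingHom.id_apply,
          mul_left_comm _ c]
        rw [integral_const_mul, mul_neg] }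
  have hA : ∀ x, MemLp (A x) 2 (volume.restrict Ω) := fun x => x.2.1.memLp_grad
  have hAi : ∀ x, Integrable (A x) (volume.restrict Ω) := fun x => (hA x).integrable one_le_two
  have hFi := hF.integrable one_le_two
  have hlθ : ∀ x, l x ≤ θ * C * ∫ y in Ω, ‖A x y‖ := fun x => by
    calc l x ≤ ‖∫ y in Ω, H y * x.1.1 y‖ := neg_le_abs _
      _ ≤ ∫ y in Ω, ‖H y * x.1.1 y‖ := norm_integral_le_integral_norm _
      _ ≤ ∫ y in Ω, θ * ‖x.1.1 y‖ := by
        refine integral_mono_ae (hHv x).norm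
          ((x.2.1.memLp.integrable one_le_two).norm.const_mul θ) ?_
        filter_upwards [hHθ] with y hy
        rw [norm_mul]
        exact mul_le_mul_of_nonneg_right hy (norm_nonneg _)
      _ = θ * ∫ y in Ω, ‖x.1.1 y‖ := integral_const_mul _ _
      _ ≤ θ * (C * ∫ y in Ω, ‖A x y‖) :=
        mul_le_mul_of_nonneg_left (hP _ _ x.2.1 x.2.2) hθ
      _ = _ := (mul_assoc _ _ _).symm
  have hA0 : ∀ x, 0 ≤ ∫ y in Ω, ‖A x y‖ := fun x => integral_nonneg fun y => norm_nonneg _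
  obtain ⟨N, hNm, hN1, hNl, x, ⟨M, hM⟩, hx⟩ := exists_calibration A hA l
    (fun x => (hlθ x).trans (mul_le_of_le_one_left (hA0 x) hθC.le)) hF
  have hN2 : MemLp N 2 (volume.restrict Ω) := MemLp.of_bound hNm.aestronglyMeasurable 1 hN1
  -- Coercivity: `J ≤ M` and `l ≤ θ C ∫ |∇u|` give `(1 - θ C) ∫ |∇u| ≤ M + ∫ |F|`, which uses `θ C <
  -- 1` strictly.
  have hGM : ∀ k, ∫ y in Ω, ‖A (x k) y‖ ≤ (M + ∫ y in Ω, ‖F y‖) / (1 - θ * C) := fun k => by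
    rw [le_div_iff₀ (by linarith)]
    have h1 : ∫ y in Ω, ‖A (x k) y‖ ≤ ∫ y in Ω, (‖A (x k) y + F y‖ + ‖F y‖) := by
      refine integral_mono (hAi _).norm (((hAi _).add hFi).norm.add hFi.norm) fun y => ?_
      simpa using norm_sub_le (A (x k) y + F y) (F y)
    have h2 : Integrable (fun y => ‖A (x k) y + F y‖) (volume.restrict Ω) :=
      ((hAi _).add hFi).norm
    rw [integral_add h2 hFi.norm] at h1
    linarith [hM k, hlθ (x k)]
  refine ⟨N, hNm, hN1, ⟨hN2, fun v G hv hv0 => ?_⟩, fun k => (x k).1.1, fun k => (x k).1.2,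
    max (C * ((M + ∫ y in Ω, ‖F y‖) / (1 - θ * C))) ((M + ∫ y in Ω, ‖F y‖) / (1 - θ * C)),
    fun k => (x k).2.1, fun k => le_max_of_le_left ?_, fun k => le_max_of_le_right (hGM k), hx⟩
  · have h1 : -∫ y in Ω, H y * v y = ∫ y in Ω, inner ℝ (N y) (G y) := hNl ⟨(v, G), hv, hv0⟩
    rw [integral_add (integrable_inner_of_memLp hv.memLp_grad hN2) (hHv ⟨(v, G), hv, hv0⟩)]
    simp only [real_inner_comm] at h1 ⊢
    linarith
  · exact (hP _ _ (x k).2.1 (x k).2.2).trans (mul_le_mul_of_nonneg_left (hGM k) hC.le)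

lemma tendsto_integral_smul_of_tendsto_lintegral {V : Type*} [NormedAddCommGroup V]
    [NormedSpace ℝ V] {ι : Type*} {l : Filter ι} {μ : Measure (Euc n)} {u : ι → Euc n → ℝ}
    {w : Euc n → ℝ} (hu : ∀ k, Integrable (u k) μ) (hw : Integrable w μ)
    (h : Tendsto (fun k => ∫⁻ x, ‖u k x - w x‖ₑ ∂μ) l (𝓝 0)) {g : Euc n → V}
    (hg : AEStronglyMeasurable g μ) {C : ℝ≥0} (hC : ∀ᵐ x ∂μ, ‖g x‖ ≤ C) :
    Tendsto (fun k => ∫ x, u k x • g x ∂μ) l (𝓝 (∫ x, w x • g x ∂μ)) := by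
  refine tendsto_integral_of_L1 _ (hw.smul_bdd C hg hC).1
    (Eventually.of_forall fun k => (hu k).smul_bdd C hg hC) ?_
  have h1 := ENNReal.Tendsto.mul_const (b := (C : ℝ≥0∞)) h (Or.inr ENNReal.coe_ne_top)
  rw [zero_mul] at h1
  refine tendsto_of_tendsto_of_tendsto_of_le_of_le tendsto_const_nhds h1 (fun _ => zero_le) ?_
  intro k
  simp only
  rw [← lintegral_mul_const' _ _ ENNReal.coe_ne_top]
  refine lintegral_mono_ae ?_
  filter_upwards [hC] with x hx
  rw [Pi.smul_apply', ← sub_smul, enorm_smul]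
  gcongr
  rw [enorm_le_coe]
  exact hx

lemma IsTestFunction.exists_boundedContinuousFunction {φ : Euc n → ℝ} (hφ : IsTestFunction Ω φ) :
    ∃ f : Euc n →ᵇ ℝ, ⇑f = φ := by
  obtain ⟨C, -, hC⟩ := hφ.exists_bound
  exact ⟨.ofNormedAddCommGroup φ hφ.smooth.continuous C hC, rfl⟩

lemma IsTestFunction.setIntegral_eq {V : Type*} [NormedAddCommGroup V] [NormedSpace ℝ V]
    {φ : Euc n → ℝ} (hφ : IsTestFunction Ω φ) (ν : Measure (Euc n)) (g : Euc n → V) :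
    ∫ x in Ω, φ x • g x ∂ν = ∫ x, φ x • g x ∂ν := by
  refine setIntegral_eq_integral_of_forall_compl_eq_zero fun x hx => ?_
  rw [image_eq_zero_of_notMem_tsupport fun h => hx (hφ.support_subset h), zero_smul]

lemma HasH1Gradient.congr {u u' : Euc n → ℝ} {G G' : Euc n → Euc n}
    (hu : HasH1Gradient Ω u G) (h : u' =ᵐ[volume.restrict Ω] u)
    (h' : G' =ᵐ[volume.restrict Ω] G) (hw : IsWeakGradient Ω u' G') : HasH1Gradient Ω u' G' :=
  ⟨hu.memLp.ae_eq h.symm, hu.memLp_grad.ae_eq h'.symm, hw⟩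

lemma lintegral_enorm_eq_ofReal_of_eq_zero {V : Type*} [NormedAddCommGroup V]
    (hm : MeasurableSet Ω) {f g : Euc n → V} (hf : Integrable f) (hf0 : ∀ x ∉ Ω, f x = 0)
    (hfg : f =ᵐ[volume.restrict Ω] g) :
    ∫⁻ x, ‖f x‖ₑ = ENNReal.ofReal (∫ x in Ω, ‖g x‖) := by
  have h1 : Ω.indicator f = f := indicator_eq_self.2 fun x hx => by_contra fun h => hx (hf0 x h)
  have h2 : ∫ x in Ω, ‖g x‖ = ∫ x in Ω, ‖f x‖ := integral_congr_ae (hfg.symm.fun_comp norm)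
  rw [h2, ofReal_integral_norm_eq_lintegral_enorm hf.restrict,
    ← lintegral_indicator hm]
  refine lintegral_congr fun x => ?_
  by_cases hx : x ∈ Ω
  · rw [indicator_of_mem hx]
  · rw [indicator_of_notMem hx, hf0 x hx, enorm_zero]

/-- Both conclusions are limits of identities for the `H¹` sequence. The terms in `u` pass by `L¹`
convergence against bounded functions, those in `∇u + F` by vague convergence. -/
theorem exists_limit_of_calibrated_sequence (hΩ : IsOpen Ω) (hne : Ω.Nonempty)
    (hb : Bornology.IsBounded Ω) (hlip : HasLipschitzBoundary Ω)
    {F N : Euc n → Euc n} {H : Euc n → ℝ} {θ : ℝ} (hF : MemLp F 2 (volume.restrict Ω))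
    (hHm : AEStronglyMeasurable H (volume.restrict Ω)) (hθ : 0 ≤ θ)
    (hHθ : ∀ᵐ x ∂(volume.restrict Ω), ‖H x - ⨍ y in Ω, H y‖ ≤ θ)
    (hNm : StronglyMeasurable N) (hN1 : ∀ᵐ x ∂(volume.restrict Ω), ‖N x‖ ≤ 1)
    (hN : N ∈ DZero Ω H) {u : ℕ → Euc n → ℝ} {G : ℕ → Euc n → Euc n} {M : ℝ}
    (hu : ∀ k, HasH1Gradient Ω (u k) (G k)) (huM : ∀ k, ∫ x in Ω, ‖u k x‖ ≤ M)
    (hGM : ∀ k, ∫ x in Ω, ‖G k x‖ ≤ M)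
    (hlim : Tendsto (fun k => ∫ x in Ω, (‖G k x + F x‖ - inner ℝ (N x) (G k x + F x)))
      atTop (𝓝 0)) :
    ∃ (w : Euc n → ℝ) (ν : Measure (Euc n)) (τ : Euc n → Euc n), IntegrableOn w Ω ∧
      IsFiniteMeasure ν ∧ ν Ωᶜ = 0 ∧ StronglyMeasurable τ ∧ (∀ᵐ x ∂ν, ‖τ x‖ ≤ 1) ∧
      (∀ ψ, IsTestFunction Ω ψ →
        ∫ x in Ω, w x • ∇ ψ x = -(∫ x, ψ x • τ x ∂ν - ∫ x in Ω, ψ x • F x)) ∧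
      ∀ φ, IsTestFunction Ω φ →
        pairing Ω N (fun x => H x - ⨍ y in Ω, H y) w φ + ∫ x in Ω, φ x * inner ℝ (N x) (F x) =
          ∫ x, φ x ∂ν := by
  have hfin : IsFiniteMeasure (volume.restrict Ω) := ⟨by simpa using hb.measure_lt_top⟩
  have hm := hΩ.measurableSet
  have hFi := hF.integrable one_le_two
  choose v W hvW hvu hWG using fun k => (hu k).exists_sobolevPair hΩ hb
  have hv : ∀ k, HasH1Gradient Ω (v k) (W k) := fun k =>
    (hu k).congr (hvu k) (hWG k) (hvW k).isWeakGradient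
  have hvi : ∀ k, Integrable (v k) (volume.restrict Ω) := fun k => (hvW k).integrable.restrict
  have hWi : ∀ k, Integrable (W k) (volume.restrict Ω) := fun k =>
    (hvW k).integrable_grad.restrict
  have hvM : ∀ k, ∫⁻ x, ‖v k x‖ₑ ≤ M.toNNReal := fun k => by
    rw [lintegral_enorm_eq_ofReal_of_eq_zero hm (hvW k).integrable (hvW k).eq_zero (hvu k)]
    exact ENNReal.ofReal_le_ofReal (huM k)
  have hWM : ∀ k, ∫⁻ x, ‖W k x‖ₑ ≤ M.toNNReal := fun k => by
    rw [lintegral_enorm_eq_ofReal_of_eq_zero hm (hvW k).integrable_grad (hvW k).grad_eq_zero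
      (hWG k)]
    exact ENNReal.ofReal_le_ofReal (hGM k)
  have hTi : ∀ k, Integrable (fun x => W k x + F x) (volume.restrict Ω) := fun k =>
    (hWi k).add hFi
  have hT2 : ∀ k, MemLp (fun x => W k x + F x) 2 (volume.restrict Ω) := fun k =>
    (hv k).memLp_grad.add hF
  have hTM : ∀ k, ∫⁻ x in Ω, ‖W k x + F x‖ₑ ≤
      (M.toNNReal + (∫⁻ x in Ω, ‖F x‖ₑ).toNNReal : ℝ≥0) := fun k => by
    calc ∫⁻ x in Ω, ‖W k x + F x‖ₑ ≤ ∫⁻ x in Ω, (‖W k x‖ₑ + ‖F x‖ₑ) :=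
          lintegral_mono fun x => enorm_add_le _ _
      _ = (∫⁻ x in Ω, ‖W k x‖ₑ) + ∫⁻ x in Ω, ‖F x‖ₑ := lintegral_add_left' (hWi k).1.enorm _
      _ ≤ _ := by
        rw [ENNReal.coe_add, ENNReal.coe_toNNReal hFi.2.ne]
        exact add_le_add_left ((lintegral_mono' Measure.restrict_le_self le_rfl).trans (hWM k)) _
  have hlim' : Tendsto (fun k => ∫ x in Ω, (‖W k x + F x‖ - inner ℝ (N x) (W k x + F x)))
      (hyperfilter ℕ) (𝓝 0) := by
    refine (hlim.mono_left Nat.hyperfilter_le_atTop).congr fun k => integral_congr_ae ?_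
    filter_upwards [hWG k] with x hx
    rw [hx]
  obtain ⟨w, hw, hvw⟩ := exists_tendsto_lintegral_sub (hyperfilter ℕ) hΩ hb hlip hvW hvM hWM
  obtain ⟨ν, τ, hν, hτm, hτ, hν1, hν2⟩ := exists_limit_measure (μ := volume.restrict Ω)
    (hyperfilter ℕ) hb.isCompact_closure
    (by
      rw [Measure.restrict_apply isClosed_closure.measurableSet.compl]
      rw [(disjoint_compl_left_iff_subset.2 subset_closure).inter_eq, measure_empty]) hTi hTM
  -- Mass may accumulate on the boundary; it is discarded, since test functions supported in `Ω` do
  -- not see it.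
  refine ⟨w, ν.restrict Ω, τ, hw, inferInstance, ?_, hτm, ae_restrict_of_ae hτ, fun ψ hψ => ?_,
    fun φ hφ => ?_⟩
  · rw [Measure.restrict_apply hm.compl, compl_inter_self, measure_empty]
  · have hτi : Integrable τ ν := Integrable.of_bound hτm.aestronglyMeasurable 1 hτ
    obtain ⟨C, hC0, hC⟩ := hψ.exists_gradient_bound
    refine ext_inner_left ℝ fun e => ?_
    have h1 : Tendsto (fun k => inner ℝ e (∫ x in Ω, v k x • ∇ ψ x)) (hyperfilter ℕ)
        (𝓝 (inner ℝ e (∫ x in Ω, w x • ∇ ψ x))) :=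
      tendsto_const_nhds.inner (tendsto_integral_smul_of_tendsto_lintegral (C := ⟨C, hC0⟩) hvi hw
        hvw hψ.continuous_gradient.aestronglyMeasurable (Eventually.of_forall hC))
    obtain ⟨f, hf⟩ : ∃ f : Euc n →ᵇ Euc n, ∀ x, f x = ψ x • e := by
      obtain ⟨C, -, hC⟩ := hψ.exists_bound
      refine ⟨.ofNormedAddCommGroup (fun x => ψ x • e) (hψ.smooth.continuous.smul continuous_const)
        (C * ‖e‖) fun x => ?_, fun x => rfl⟩
      rw [norm_smul]
      exact mul_le_mul_of_nonneg_right (hC x) (norm_nonneg _)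
    have h2 := hν2 f
    have h3 : ∀ k, inner ℝ e (∫ x in Ω, v k x • ∇ ψ x) =
        -((∫ x in Ω, inner ℝ (f x) (W k x + F x)) - inner ℝ e (∫ x in Ω, ψ x • F x)) := fun k => by
      have i1 : Integrable (fun x => ψ x • W k x) (volume.restrict Ω) :=
        hψ.integrable_smul (hWi k)
      have i2 : Integrable (fun x => ψ x • F x) (volume.restrict Ω) := hψ.integrable_smul hFi
      have h4 : ∫ x in Ω, inner ℝ (f x) (W k x + F x) =
          inner ℝ e (∫ x in Ω, ψ x • (W k x + F x)) := by
        rw [← integral_inner (hψ.integrable_smul (hTi k))]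
        simp only [hf, real_inner_smul_left, real_inner_smul_right]
      rw [(hvW k).isWeakGradient ψ hψ, h4]
      simp only [smul_add]
      rw [integral_add i1 i2, inner_add_right, inner_neg_right]
      ring
    simp only [h3] at h1
    have h5 := tendsto_nhds_unique h1 ((h2.sub_const _).neg)
    rw [h5, hψ.setIntegral_eq ν, inner_neg_right, inner_sub_right,
      ← integral_inner (hψ.integrable_smul hτi)]
    simp only [hf, real_inner_smul_right, real_inner_comm]
  · obtain ⟨f, hf⟩ := hφ.exists_boundedContinuousFunction
    obtain ⟨C, hC0, hC⟩ := hφ.exists_bound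
    obtain ⟨C', hC0', hC'⟩ := hφ.exists_gradient_bound
    have h1 := hν1 f
    simp only [hf] at h1
    have hH2 : MemLp H 2 (volume.restrict Ω) := by
      have := MemLp.of_bound (p := 2) (hHm.sub aestronglyMeasurable_const) θ hHθ
      simpa using this.add (memLp_const (⨍ y in Ω, H y))
    have h2 : Tendsto (fun k => pairing Ω N (fun x => H x - ⨍ y in Ω, H y) (v k) φ)
        (hyperfilter ℕ) (𝓝 (pairing Ω N (fun x => H x - ⨍ y in Ω, H y) w φ)) := by
      have t1 := tendsto_integral_smul_of_tendsto_lintegral (C := ⟨C * θ, by positivity⟩) hvi hw hvw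
        (g := fun x => φ x * (H x - ⨍ y in Ω, H y))
        (hφ.smooth.continuous.aestronglyMeasurable.mul (hHm.sub aestronglyMeasurable_const)) (by
          filter_upwards [hHθ] with x hx
          rw [norm_mul]
          exact mul_le_mul (hC x) hx (norm_nonneg _) hC0)
      have t2 := tendsto_integral_smul_of_tendsto_lintegral (C := ⟨C', hC0'⟩) hvi hw hvw
        (g := fun x => inner ℝ (N x) (∇ φ x))
        (hNm.aestronglyMeasurable.inner hφ.continuous_gradient.aestronglyMeasurable) (by
          filter_upwards [hN1] with x hx
          refine (norm_inner_le_norm _ _).trans ?_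
          exact (mul_le_of_le_one_left (norm_nonneg _) hx).trans (hC' x))
      simpa only [pairing, smul_eq_mul, mul_assoc] using t1.neg.sub t2
    have i1 : ∀ k, Integrable (fun x => inner ℝ (N x) (W k x + F x)) (volume.restrict Ω) :=
      fun k => integrable_inner_of_memLp hN.1 (hT2 k)
    -- For `H¹` functions the left side is `∫ φ N · (∇u + F)`, that is, the mass `∫ φ |∇u + F|`
    -- minus the weighted defect.
    have h3 : ∀ k, pairing Ω N (fun x => H x - ⨍ y in Ω, H y) (v k) φ +
        ∫ x in Ω, φ x * inner ℝ (N x) (F x) =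
        (∫ x in Ω, φ x * ‖W k x + F x‖) -
          ∫ x in Ω, φ x * (‖W k x + F x‖ - inner ℝ (N x) (W k x + F x)) := fun k => by
      rw [pairing_eq_of_mem_DZero hΩ hne hb hN hH2 (hv k) hφ, ← integral_add, ← integral_sub]
      · refine integral_congr_ae (Eventually.of_forall fun x => ?_)
        simp only [inner_add_right]
        ring
      · exact hφ.integrable_smul (hTi k).norm
      · exact hφ.integrable_smul ((hTi k).norm.sub (i1 k))
      · exact hφ.integrable_smul (integrable_inner_of_memLp hN.1 (hv k).memLp_grad)
      · exact hφ.integrable_smul (integrable_inner_of_memLp hN.1 hF)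
    -- The defect is nonnegative because `|N| ≤ 1`, so the weight `φ` costs only the factor `C`.
    have h4 : Tendsto
        (fun k => ∫ x in Ω, φ x * (‖W k x + F x‖ - inner ℝ (N x) (W k x + F x)))
        (hyperfilter ℕ) (𝓝 0) := by
      refine squeeze_zero_norm (fun k => ?_) (by simpa using hlim'.const_mul C)
      refine norm_integral_le_of_norm_le (((hTi k).norm.sub (i1 k)).const_mul C) ?_ |>.trans_eq
        (integral_const_mul _ _)
      filter_upwards [hN1] with x hx
      have h5 : 0 ≤ ‖W k x + F x‖ - inner ℝ (N x) (W k x + F x) := sub_nonneg.2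
        ((real_inner_le_norm _ _).trans (mul_le_of_le_one_left (norm_nonneg _) hx))
      rw [norm_mul, Real.norm_of_nonneg h5]
      exact mul_le_mul_of_nonneg_right (hC x) h5
    have h5 := (h2.add_const (∫ x in Ω, φ x * inner ℝ (N x) (F x))).congr h3
    have h6 := tendsto_nhds_unique h5 (h1.sub h4)
    rw [h6, sub_zero]
    simpa using (hφ.setIntegral_eq ν fun _ => (1 : ℝ)).symm

end Existence

/-! ### The limit function is in `BV(Ω)` -/

section BVGradient

variable {n : ℕ} {Ω : Set (Euc n)}

lemma variation_withDensityᵥ_of_norm_eq_one {ν : Measure (Euc n)} {τ : Euc n → Euc n}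
    (hτ : Integrable τ ν) (h : ∀ᵐ x ∂ν, ‖τ x‖ = 1) : (ν.withDensityᵥ τ).variation = ν := by
  rw [Measure.variation_withDensityᵥ hτ]
  have h1 : (fun x => ‖τ x‖ₑ) =ᵐ[ν] 1 := by
    filter_upwards [h] with x hx
    rw [← ofReal_norm, hx, ENNReal.ofReal_one, Pi.one_apply]
  rw [withDensity_congr_ae h1, withDensity_one]

/-- Here `Du = τ ν - F dx`, whose variation is at most `ν + |F| dx`: finite, and null off `Ω`. -/
lemma hasBVGradient_sub_withDensityᵥ (hm : MeasurableSet Ω) {u : Euc n → ℝ} {F τ : Euc n → Euc n}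
    {ν : Measure (Euc n)} [IsFiniteMeasure ν] (hν : ν Ωᶜ = 0) (hu : IntegrableOn u Ω)
    (hτ : Integrable τ ν) (hτ1 : ∀ᵐ x ∂ν, ‖τ x‖ = 1) (hF : IntegrableOn F Ω)
    (hgrad : ∀ ψ, IsTestFunction Ω ψ →
      ∫ x in Ω, u x • ∇ ψ x = -(∫ x, ψ x • τ x ∂ν - ∫ x in Ω, ψ x • F x)) :
    HasBVGradient Ω u (ν.withDensityᵥ τ - (volume.restrict Ω).withDensityᵥ F) := by
  have hfin := isFiniteMeasure_variation_withDensityᵥ hF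
  have hle : (ν.withDensityᵥ τ - (volume.restrict Ω).withDensityᵥ F).variation ≤
      ν + ((volume.restrict Ω).withDensityᵥ F).variation :=
    VectorMeasure.variation_sub_le.trans_eq
      (by rw [variation_withDensityᵥ_of_norm_eq_one hτ hτ1])
  refine ⟨hu, (hle _).trans_lt (measure_lt_top _ _), ?_, fun φ hφ => ?_⟩
  · refine le_antisymm ((hle _).trans_eq ?_) zero_le
    rw [Measure.add_apply, hν, zero_add, Measure.variation_withDensityᵥ hF]
    refine withDensity_absolutelyContinuous _ _ ?_
    rw [Measure.restrict_apply hm.compl, compl_inter_self, measure_empty]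
  · obtain ⟨C, hC0, hC⟩ := hφ.exists_bound
    have hφm := hφ.smooth.continuous.stronglyMeasurable
    have hfin' := isFiniteMeasure_variation_withDensityᵥ hτ
    rw [VectorMeasure.integral_sub_vectorMeasure (hφ.integrable_of_bound _)
      (hφ.integrable_of_bound _), integral_withDensityᵥ hτ hφm hC0 hC,
      integral_withDensityᵥ hF hφm hC0 hC, hgrad φ hφ]

end BVGradient

end PArea

end

/-! ### The theorem -/

theorem mainTheorem10 (n : ℕ) (hn : 1 ≤ n) (Ω : Set (PArea.Euc n)) (hΩ_open : IsOpen Ω)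
    (hΩ_conn : IsConnected Ω) (hΩ_bdd : Bornology.IsBounded Ω)
    (hΩ_lip : PArea.HasLipschitzBoundary Ω) :
    ∃ C : ℝ, 0 < C ∧
      ∀ (F : PArea.Euc n → PArea.Euc n) (H : PArea.Euc n → ℝ),
        MemLp F 2 (volume.restrict Ω) →
        AEStronglyMeasurable H (volume.restrict Ω) →
        eLpNorm H ⊤ (volume.restrict Ω) < ENNReal.ofReal C →
        ∃ (u : PArea.Euc n → ℝ) (D : VectorMeasure (PArea.Euc n) (PArea.Euc n))
          (N : PArea.Euc n → PArea.Euc n),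
          PArea.HasBVGradient Ω u D ∧
          N ∈ PArea.DZero Ω H ∧
          (∀ᵐ x ∂(volume.restrict Ω), ‖N x‖ ≤ 1) ∧
          PArea.IsWeakDivergence Ω N (fun x => H x - ⨍ y in Ω, H y) ∧
          PArea.IsPolarDensity (PArea.addField Ω D F) N ∧
          (∀ φ : PArea.Euc n → ℝ, PArea.IsTestFunction Ω φ →
            PArea.pairing Ω N (fun x => H x - ⨍ y in Ω, H y) u φ
                + ∫ x in Ω, φ x * inner ℝ (N x) (F x)
              = ∫ x, φ x ∂(PArea.addField Ω D F).variation) := by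
  classical
  obtain ⟨C, hC, hP⟩ := PArea.exists_poincare_constant hΩ_open hΩ_conn hΩ_bdd hΩ_lip
  -- With the Poincaré constant `C`, the bound on `H` reads `θ * C < 1`.
  refine ⟨C⁻¹, inv_pos.2 hC, fun F H hF hHm hH => ?_⟩
  have hfin : IsFiniteMeasure (volume.restrict Ω) := ⟨by simpa using hΩ_bdd.measure_lt_top⟩
  have hne := hΩ_conn.nonempty
  have hFi := hF.integrable one_le_two
  set θ := (eLpNorm H ⊤ (volume.restrict Ω)).toReal with hθ
  have hθ0 : 0 ≤ θ := ENNReal.toReal_nonneg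
  have hHθ : ∀ᵐ x ∂(volume.restrict Ω), ‖H x‖ ≤ θ := by
    filter_upwards [ae_le_eLpNormEssSup (f := H) (μ := volume.restrict Ω)] with x hx
    rw [hθ, eLpNorm_exponent_top, ← toReal_enorm]
    exact ENNReal.toReal_mono (by simpa using hH.ne_top) hx
  have hθC : θ * C < 1 := by
    rw [← lt_div_iff₀ hC, one_div]
    exact (ENNReal.lt_ofReal_iff_toReal_lt hH.ne_top).1 hH
  obtain ⟨N, hNm, hN1, hN, u, G, M, hu, huM, hGM, hlim⟩ :=
    PArea.exists_calibrated_sequence hΩ_bdd hC hP hF hHm hθ0 hHθ hθC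
  have hH2 : MemLp H 2 (volume.restrict Ω) := MemLp.of_bound hHm θ hHθ
  have hdm : AEStronglyMeasurable (fun x => H x - ⨍ y in Ω, H y) (volume.restrict Ω) :=
    hHm.sub aestronglyMeasurable_const
  have hc : 0 ≤ θ + ‖⨍ y in Ω, H y‖ := add_nonneg hθ0 (norm_nonneg _)
  have hd : ∀ᵐ x ∂(volume.restrict Ω), ‖H x - ⨍ y in Ω, H y‖ ≤ θ + ‖⨍ y in Ω, H y‖ := by
    filter_upwards [hHθ] with x hx
    exact (norm_sub_le _ _).trans (add_le_add hx le_rfl)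
  obtain ⟨w, ν, τ, hw, hν, hνΩ, hτm, hτ, hgrad, hcal⟩ :=
    PArea.exists_limit_of_calibrated_sequence hΩ_open hne hΩ_bdd hΩ_lip hF hHm hc hd hNm hN1 hN hu
      huM hGM hlim
  have hτi : Integrable τ ν := Integrable.of_bound hτm.aestronglyMeasurable 1 hτ
  obtain ⟨hτ1, Z, hZ, hZ0, hNτ⟩ := PArea.ae_eq_of_pairing_eq hΩ_open hΩ_bdd hνΩ hNm hN1 hdm hc hd
    (PArea.isWeakDivergence_of_mem_DZero hΩ_open hne hΩ_bdd hN hH2) hw hτm hτ hFi hgrad hcal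
  -- The representative of the theorem equals `τ` on the Lebesgue null set `Z`. All Lebesgue
  -- integrals are unchanged, and it equals `τ` almost everywhere for `ν`.
  have h1 : Z.piecewise τ N =ᵐ[volume.restrict Ω] N := by
    refine ae_restrict_of_ae ?_
    filter_upwards [measure_eq_zero_iff_ae_notMem.1 hZ0] with x hx
    exact piecewise_eq_of_notMem _ _ _ hx
  have h2 : Z.piecewise τ N =ᵐ[ν] τ := by
    filter_upwards [hNτ] with x hx
    by_cases hxZ : x ∈ Z
    · exact piecewise_eq_of_mem _ _ _ hxZ
    · rw [piecewise_eq_of_notMem _ _ _ hxZ, hx hxZ]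
  have hadd : PArea.addField Ω (ν.withDensityᵥ τ - (volume.restrict Ω).withDensityᵥ F) F =
      ν.withDensityᵥ τ := sub_add_cancel _ _
  have hvar := PArea.variation_withDensityᵥ_of_norm_eq_one hτi hτ1
  have hD : Z.piecewise τ N ∈ PArea.DZero Ω H := by
    refine ⟨hN.1.ae_eq h1.symm, fun v G hv hv0 => ?_⟩
    rw [← hN.2 v G hv hv0]
    refine integral_congr_ae ?_
    filter_upwards [h1] with x hx
    rw [hx]
  refine ⟨w, _, Z.piecewise τ N, PArea.hasBVGradient_sub_withDensityᵥ hΩ_open.measurableSet hνΩ hw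
    hτi hτ1 hFi hgrad, hD, ?_, PArea.isWeakDivergence_of_mem_DZero hΩ_open hne hΩ_bdd hD hH2,
    ?_, fun φ hφ => ?_⟩
  · filter_upwards [h1, hN1] with x hx hx1
    rwa [hx]
  · rw [hadd, PArea.IsPolarDensity, hvar]
    have h3 : Integrable (Z.piecewise τ N) ν := hτi.congr h2.symm
    exact ⟨h3, (h3.withDensityᵥ_eq_iff hτi).2 h2⟩
  · rw [hadd, hvar, ← hcal φ hφ, PArea.pairing, PArea.pairing]
    congr 1
    · congr 1
      refine integral_congr_ae ?_
      filter_upwards [h1] with x hx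
      rw [hx]
    · refine integral_congr_ae ?_
      filter_upwards [h1] with x hx
      rw [hx]
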